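/- Let $\varepsilon>0$ and $\gamma\in\mathbb R$ with $\gamma\neq 1$ and $\gamma\neq\sqrt\varepsilon$. Put $$G(q)=(1-\gamma)\cos(q\sqrt\varepsilon)\cos q-\Bigl(\sqrt\varepsilon-\frac{\gamma}{\sqrt\varepsilon}\Bigr)\sin(q\sqrt\varepsilon)\sin q ,$$ and consider the root equation $\tan q=\frac{\gamma}{\sqrt\varepsilon}\tan(q\sqrt\varepsilon)$ together with its form without denominators, $$\sin q\cos(q\sqrt\varepsilon)=\frac{\gamma}{\sqrt\varepsilon}\cos q\sin(q\sqrt\varepsilon).\qquad(*)$$ Assume that (a) $\gamma\le 0$, or all complex solutions $q$ of $(*)$ are real; and (b) $\gamma<0$, or $G(q)\neq0$ for every positive solution $q$ of $(*)$. Then the positive real roots of $\tan q=\frac{\gamma}{\sqrt\varepsilon}\tan(q\sqrt\varepsilon)$ (both tangents being defined) form an infinite strictly increasing sequence $q_1<q_2<\cdots$, one has $G(q_n)\ne0$ for all $n$, and for every real $p>0$ the denominator on the right below is non-zero, the series converges absolutely, and $$\frac{1}{1-\gamma}+2\sum_{n=1}^{\infty}\frac{\cos(q_n\sqrt\varepsilon)\cos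 q_n}{(1+q_n^2/p)\,G(q_n)}=\frac{\sqrt p\,\coth\sqrt p}{1-\frac{\gamma}{\sqrt\varepsilon}\coth\sqrt p\,\tanh\sqrt{\varepsilon p}} .$$ Moreover, if $\gamma=0$ and $\varepsilon>0$ is such that $\cos(n\pi\sqrt\varepsilon)\ne0$ for all $n\ge1$, then (a) and (b) hold, the positive roots are exactly $q_n=n\pi$, $n\ge1$, and the $n$-th summand equals $1/(1+n^2\pi^2/p)$. For every real $p>0$, $$1+2\sum_{n=1}^{\infty}\frac{1}{1+n^2\pi^2/p}=\sqrt p\,\coth\sqrt p ,$$ and in particular (for $p=\pi^2$) $$1+2\sum_{n=1}^{\infty}\frac1{1+n^2}=\pi\coth\pi ,$$ both series being convergent. -/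

import Mathlib

/-- The real hyperbolic cotangent `coth x = cosh x / sinh x` (used only for `x > 0`). -/
noncomputable def coth (x : ℝ) : ℝ := Real.cosh x / Real.sinh x

/-- The positive roots of `tan q = (γ / √ε) tan (q √ε)`. Both tangents are required to be
defined, so that the value `0` that Lean gives to `tan` at its poles plays no role. -/
def posRoots (ε γ : ℝ) : Set ℝ :=
  {q | 0 < q ∧ Real.cos q ≠ 0 ∧ Real.cos (q * √ε) ≠ 0 ∧
    Real.tan q = γ / √ε * Real.tan (q * √ε)}

/-- `G(q) = (1 - γ) cos (q √ε) cos q - (√ε - γ / √ε) sin (q √ε) sin q`. -/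
noncomputable def G (ε γ q : ℝ) : ℝ :=
  (1 - γ) * Real.cos (q * √ε) * Real.cos q -
    (√ε - γ / √ε) * Real.sin (q * √ε) * Real.sin q

/-- The summand `cos (q √ε) cos q / ((1 + q² / p) G(q))`. -/
noncomputable def summand (ε γ p q : ℝ) : ℝ :=
  Real.cos (q * √ε) * Real.cos q / ((1 + q ^ 2 / p) * G ε γ q)

/-- The root equation multiplied by `cos z cos (z √ε)` has real solutions only. -/
def OnlyRealRoots (ε γ : ℝ) : Prop :=
  ∀ z : ℂ, Complex.sin z * Complex.cos (z * (√ε : ℝ)) =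
    ((γ / √ε : ℝ) : ℂ) * (Complex.cos z * Complex.sin (z * (√ε : ℝ))) → z.im = 0

/-- The function `sin q cos (q √ε) - (γ / √ε) cos q sin (q √ε)`, whose derivative is `G`, has
no multiple positive zero. -/
def OnlySimpleRoots (ε γ : ℝ) : Prop :=
  ∀ q : ℝ, 0 < q → Real.sin q * Real.cos (q * √ε) =
    γ / √ε * (Real.cos q * Real.sin (q * √ε)) → G ε γ q ≠ 0

/-! Put a = √ε, k = γ/√ε and F(z) = sin z cos(az) - k cos z sin(az). Then F is odd and entire, F' =
G on the real line, F'(0) = 1 - γ, and by hypothesis all zeros of F are real and simple. The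
identity is the partial fraction expansion of cos(az) cos z / F(z) at z = ±i√p. The zero q = 0 gives
1/(1 - γ), the zeros ±q give equal terms, and zeros where a cosine vanishes give nothing.

For H entire with |H| = O(exp((1 + a)|Im z|)), the residue theorem is applied to H(z)/(F(z)(z -
b₁)(z - b₂)) on circles where |F| ≥ c exp((1 + a)|Im z|) (`exists_tendsto_sum_residues`). Far from
the real axis this bound holds because sin((1 + a)z) dominates F, as k ≠ 1. Near the axis it comes
from almost periodicity: F has no zero on a vertical line Re z = x₀ with F(x₀) ≠ 0, and Dirichlet
approximation reproduces that line near arbitrarily large x₀ + 2πm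
(`exists_circle_le_norm_rootFun`).

This gives convergence along growing discs only. Absolute convergence follows from two facts: Σ
1/(q² + 1) < ∞ (take H = F', b = ±i) and the residues cos(aq) cos q / F'(q) are bounded. If k(a -
k)(1 - ka) ≤ 0, the bound is an algebraic identity at the zeros. Otherwise the Laguerre inequality
F'² - F F'' ≥ 0 fails somewhere when a is irrational, so a is rational, F is periodic, and |F'| is
bounded below on its zeros (`exists_cos_mul_cos_le`).

There are infinitely many positive roots since a finite sum would stay bounded in p while the
right-hand side grows like √p. -/

namespace RootSeries

section ComplexAnalysis

open Complex Metric Filter Topology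

/-! ### Residue theorem on discs -/

/-- The residue theorem on a disc for a quotient of entire functions with simple poles. -/
theorem circleIntegral_div_eq_sum {R : ℝ} (hR : 0 < R) (S : Finset ℂ) :
    ∀ {D H : ℂ → ℂ}, Differentiable ℂ D → Differentiable ℂ H →
      (∀ z ∈ closedBall (0 : ℂ) R, D z = 0 ↔ z ∈ S) → (∀ s ∈ S, s ∈ ball (0 : ℂ) R) →
      (∀ s ∈ S, deriv D s ≠ 0) →
      (∮ z in C(0, R), H z / D z) = 2 * Real.pi * I * ∑ s ∈ S, H s / deriv D s := by
  classical
  induction S using Finset.induction_on with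
  | empty =>
    intro D H hD hH hS _ _
    have h0 : ∀ z ∈ closedBall (0 : ℂ) R, D z ≠ 0 := fun z hz h => by simpa using (hS z hz).1 h
    rw [circleIntegral_eq_zero_of_differentiable_on_off_countable hR.le Set.countable_empty]
    · simp
    · exact hH.continuous.continuousOn.div hD.continuous.continuousOn h0
    · intro z hz
      exact (hH z).div (hD z) (h0 z (ball_subset_closedBall hz.1))
  | insert s T hs ih =>
    intro D H hD hH hS hball hsimple
    have hdiff : ∀ {f : ℂ → ℂ}, Differentiable ℂ f → Differentiable ℂ (dslope f s) := by
      intro f hf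
      rw [← differentiableOn_univ]
      exact (Complex.differentiableOn_dslope Filter.univ_mem).2 hf.differentiableOn
    have hsb : s ∈ ball (0 : ℂ) R := hball s (Finset.mem_insert_self _ _)
    have hDs : D s = 0 := (hS s (ball_subset_closedBall hsb)).2 (Finset.mem_insert_self _ _)
    set D₁ := dslope D s with hD₁
    have hD₁d : Differentiable ℂ D₁ := hdiff hD
    have hDfac : ∀ z, D z = (z - s) * D₁ z := by
      intro z
      have := sub_smul_dslope D s z
      simp only [smul_eq_mul, hDs, sub_zero] at this
      exact this.symm
    have hD₁s : D₁ s = deriv D s := dslope_same D s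
    have hD₁s0 : D₁ s ≠ 0 := hD₁s ▸ hsimple s (Finset.mem_insert_self _ _)
    -- The residue at `s`: it makes H - c D₁ vanish at `s`, so that H/D = c/(z - s) + H₁/D₁, where
    -- D₁ has one zero fewer in the disc.
    set c := H s / D₁ s with hc
    set E := fun z => H z - c * D₁ z with hE
    have hEd : Differentiable ℂ E := hH.sub (hD₁d.const_mul c)
    have hEs : E s = 0 := by simp only [hE, hc]; field_simp; simp
    set H₁ := dslope E s with hH₁
    have hH₁d : Differentiable ℂ H₁ := hdiff hEd
    have hEfac : ∀ z, E z = (z - s) * H₁ z := by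
      intro z
      have := sub_smul_dslope E s z
      simp only [smul_eq_mul, hEs, sub_zero] at this
      exact this.symm
    have hderiv : ∀ z, deriv D z = D₁ z + (z - s) * deriv D₁ z := by
      intro z
      have h1 : D = fun z => (z - s) * D₁ z := funext hDfac
      have h2 : HasDerivAt (fun z => (z - s) * D₁ z) (1 * D₁ z + (z - s) * deriv D₁ z) z :=
        ((hasDerivAt_id z).sub_const s).mul (hD₁d z).hasDerivAt
      rw [h1, h2.deriv, one_mul]
    have hS₁ : ∀ z ∈ closedBall (0 : ℂ) R, D₁ z = 0 ↔ z ∈ T := by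
      intro z hz
      by_cases hzs : z = s
      · subst hzs; exact ⟨fun h => absurd h hD₁s0, fun h => absurd h hs⟩
      · have := hS z hz
        rw [hDfac, mul_eq_zero, sub_eq_zero, Finset.mem_insert] at this
        simpa [hzs] using this
    have hne : ∀ t ∈ T, t - s ≠ 0 := fun t ht h => hs (sub_eq_zero.1 h ▸ ht)
    have hT0 : ∀ t ∈ T, D₁ t = 0 := fun t ht =>
      (hS₁ t (ball_subset_closedBall (hball t (Finset.mem_insert_of_mem ht)))).2 ht
    have hrec := ih hD₁d hH₁d hS₁ (fun t ht => hball t (Finset.mem_insert_of_mem ht))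
      (fun t ht h => hsimple t (Finset.mem_insert_of_mem ht) (by rw [hderiv, hT0 t ht, h]; simp))
    have hsph : ∀ z ∈ sphere (0 : ℂ) R, z - s ≠ 0 ∧ D₁ z ≠ 0 := by
      intro z hz
      have hz' : z ∉ ball (0 : ℂ) R := by
        rw [mem_sphere] at hz; rw [mem_ball, hz]; exact lt_irrefl _
      refine ⟨fun h => hz' (sub_eq_zero.1 h ▸ hsb), fun h => hz' ?_⟩
      exact hball z (Finset.mem_insert_of_mem ((hS₁ z (sphere_subset_closedBall hz)).1 h))
    have hint : (∮ z in C(0, R), H z / D z) =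
        ∮ z in C(0, R), (c * (z - s)⁻¹ + H₁ z / D₁ z) := by
      refine circleIntegral.integral_congr hR.le fun z hz => ?_
      obtain ⟨h1, h2⟩ := hsph z hz
      have h3 : H z = c * D₁ z + (z - s) * H₁ z := by rw [← hEfac]; simp [hE]
      simp only [hDfac z, h3]
      field_simp
    rw [hint, circleIntegral.integral_add, circleIntegral.integral_const_mul,
      circleIntegral.integral_sub_inv_of_mem_ball hsb, hrec, Finset.sum_insert hs, mul_add]
    · congr 1
      · rw [hc, hD₁s]; ring
      · congr 1
        -- At the other zeros both H and D' acquire the same factor t - s, so the residues of H₁/D₁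
        -- and H/D agree.
        refine Finset.sum_congr rfl fun t ht => ?_
        have h1 := hne t ht
        have h2 : H t = (t - s) * H₁ t := by
          rw [← hEfac]; simp [hE, hT0 t ht]
        rw [hderiv, hT0 t ht, h2, zero_add, mul_div_mul_left _ _ h1]
    · refine ContinuousOn.circleIntegrable hR.le ?_
      exact continuousOn_const.mul ((continuous_id.sub continuous_const).continuousOn.inv₀
        fun z hz => (hsph z hz).1)
    · exact ContinuousOn.circleIntegrable hR.le
        (hH₁d.continuous.continuousOn.div hD₁d.continuous.continuousOn fun z hz => (hsph z hz).2)

/-! ### The root function and its exponential growth -/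

/-- The entire function `sin z cos (a z) - k cos z sin (a z)`. -/
noncomputable def rootFun (a k : ℝ) (z : ℂ) : ℂ := sin z * cos (z * a) - k * (cos z * sin (z * a))

/-- The derivative of `rootFun`. -/
noncomputable def rootDeriv (a k : ℝ) (z : ℂ) : ℂ :=
  (1 - k * a) * (cos (z * a) * cos z) - (a - k) * (sin (z * a) * sin z)

theorem hasDerivAt_rootFun (a k : ℝ) (z : ℂ) :
    HasDerivAt (rootFun a k) (rootDeriv a k z) z := by
  have h0 : HasDerivAt (fun z : ℂ => z * (a : ℂ)) a z := by
    simpa using (hasDerivAt_id z).mul_const (a : ℂ)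
  have hs : HasDerivAt (fun z : ℂ => sin (z * a)) (cos (z * a) * a) z :=
    h0.csin
  have hc : HasDerivAt (fun z : ℂ => cos (z * a)) (-sin (z * a) * a) z :=
    h0.ccos
  refine ((((hasDerivAt_sin z).mul hc).sub
    (((hasDerivAt_cos z).mul hs).const_mul (k : ℂ)))).congr_deriv ?_
  simp only [rootDeriv]
  ring

theorem differentiable_rootFun (a k : ℝ) : Differentiable ℂ (rootFun a k) := fun z =>
  (hasDerivAt_rootFun a k z).differentiableAt

theorem differentiable_rootDeriv (a k : ℝ) : Differentiable ℂ (rootDeriv a k) := by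
  unfold rootDeriv; fun_prop

theorem rootFun_neg (a k : ℝ) (z : ℂ) : rootFun a k (-z) = -rootFun a k z := by
  simp only [rootFun, neg_mul, sin_neg, cos_neg]; ring

theorem rootDeriv_neg (a k : ℝ) (z : ℂ) : rootDeriv a k (-z) = rootDeriv a k z := by
  simp only [rootDeriv, neg_mul, sin_neg, cos_neg]; ring

theorem rootFun_zero (a k : ℝ) : rootFun a k 0 = 0 := by simp [rootFun]

theorem rootDeriv_zero (a k : ℝ) : rootDeriv a k 0 = 1 - k * a := by simp [rootDeriv]

theorem norm_exp_I_mul_le (z : ℂ) : ‖exp (z * I)‖ ≤ Real.exp |z.im| ∧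
    ‖exp (-z * I)‖ ≤ Real.exp |z.im| := by
  constructor <;> rw [norm_exp] <;> apply Real.exp_le_exp.2 <;> simp
  · exact neg_le_abs _
  · exact le_abs_self _

theorem norm_sin_le (z : ℂ) : ‖sin z‖ ≤ Real.exp |z.im| := by
  obtain ⟨h1, h2⟩ := norm_exp_I_mul_le z
  rw [Complex.sin, norm_div, norm_mul, norm_I, mul_one, Complex.norm_two]
  have := norm_sub_le (exp (-z * I)) (exp (z * I))
  linarith

theorem norm_cos_le (z : ℂ) : ‖cos z‖ ≤ Real.exp |z.im| := by
  obtain ⟨h1, h2⟩ := norm_exp_I_mul_le z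
  rw [Complex.cos, norm_div, Complex.norm_two]
  have := norm_add_le (exp (z * I)) (exp (-z * I))
  linarith

theorem le_norm_sin (z : ℂ) : (Real.exp |z.im| - 1) / 2 ≤ ‖sin z‖ := by
  rw [Complex.sin, norm_div, norm_mul, norm_I, mul_one, Complex.norm_two]
  have h1 : ‖exp (z * I)‖ = Real.exp (-z.im) := by rw [norm_exp]; simp
  have h2 : ‖exp (-z * I)‖ = Real.exp z.im := by rw [norm_exp]; simp
  rcases le_total 0 z.im with h | h
  · have h3 := norm_sub_norm_le (exp (-z * I)) (exp (z * I))
    have h4 : Real.exp (-z.im) ≤ 1 := Real.exp_le_one_iff.2 (by linarith)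
    rw [abs_of_nonneg h]
    rw [h1, h2] at h3
    linarith
  · have h3 := norm_sub_norm_le (exp (z * I)) (exp (-z * I))
    rw [norm_sub_rev] at h3
    have h4 : Real.exp z.im ≤ 1 := Real.exp_le_one_iff.2 h
    rw [abs_of_nonpos h]
    rw [h1, h2] at h3
    linarith

theorem abs_im_mul_ofReal {a : ℝ} (ha : 0 < a) (z : ℂ) : |(z * a).im| = a * |z.im| := by
  rw [im_mul_ofReal, abs_mul, abs_of_pos ha, mul_comm]

theorem exp_one_add_mul (a t : ℝ) : Real.exp t * Real.exp (a * t) = Real.exp ((1 + a) * t) := by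
  rw [← Real.exp_add]; ring_nf

theorem norm_cos_mul_cos_le {a : ℝ} (ha : 0 < a) (z : ℂ) :
    ‖cos (z * a) * cos z‖ ≤ Real.exp ((1 + a) * |z.im|) := by
  rw [norm_mul, ← exp_one_add_mul, mul_comm, ← abs_im_mul_ofReal ha]
  exact mul_le_mul (norm_cos_le _) (norm_cos_le _) (norm_nonneg _) (Real.exp_pos _).le

theorem norm_sin_mul_sin_le {a : ℝ} (ha : 0 < a) (z : ℂ) :
    ‖sin (z * a) * sin z‖ ≤ Real.exp ((1 + a) * |z.im|) := by
  rw [norm_mul, ← exp_one_add_mul, mul_comm, ← abs_im_mul_ofReal ha]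
  exact mul_le_mul (norm_sin_le _) (norm_sin_le _) (norm_nonneg _) (Real.exp_pos _).le

theorem norm_rootDeriv_le {a : ℝ} (ha : 0 < a) (k : ℝ) (z : ℂ) :
    ‖rootDeriv a k z‖ ≤ (|1 - k * a| + |a - k|) * Real.exp ((1 + a) * |z.im|) := by
  have h1 : ‖(1 - k * a : ℂ)‖ = |1 - k * a| := by
    rw [← Real.norm_eq_abs, ← Complex.norm_real]; push_cast; rfl
  have h2 : ‖(a - k : ℂ)‖ = |a - k| := by
    rw [← Real.norm_eq_abs, ← Complex.norm_real]; push_cast; rfl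
  refine (norm_sub_le _ _).trans ?_
  rw [norm_mul (1 - k * a : ℂ), norm_mul (a - k : ℂ), h1, h2, add_mul]
  exact add_le_add (mul_le_mul_of_nonneg_left (norm_cos_mul_cos_le ha z) (abs_nonneg _))
    (mul_le_mul_of_nonneg_left (norm_sin_mul_sin_le ha z) (abs_nonneg _))

/-! ### Lower bounds for the root function -/

theorem two_mul_rootFun (a k : ℝ) (z : ℂ) :
    2 * rootFun a k z = ((1 - k : ℝ) : ℂ) * sin (z * ((1 + a : ℝ) : ℂ)) +
      ((1 + k : ℝ) : ℂ) * sin (z * ((1 - a : ℝ) : ℂ)) := by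
  have h1 : z * ((1 + a : ℝ) : ℂ) = z + z * a := by push_cast; ring
  have h2 : z * ((1 - a : ℝ) : ℂ) = z - z * a := by push_cast; ring
  rw [h1, h2, sin_add, sin_sub, rootFun]
  push_cast
  ring

/-- In the sum-to-product form 2F = (1 - k) sin((1 + a)z) + (1 + k) sin((1 - a)z) the first term
dominates for large |Im z|, because k ≠ 1 and |1 - a| < 1 + a. -/
theorem exists_le_norm_rootFun_of_le_abs_im {a k : ℝ} (ha : 0 < a) (hk : k ≠ 1) :
    ∃ Y > 0, ∃ c > 0, ∀ z : ℂ, Y ≤ |z.im| → c * Real.exp ((1 + a) * |z.im|) ≤ ‖rootFun a k z‖ := by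
  have hA : 0 < |1 - k| := abs_pos.2 (sub_ne_zero.2 hk.symm)
  have hβ : |1 - a| < 1 + a := abs_lt.2 ⟨by linarith, by linarith⟩
  have hlim : Tendsto (fun t : ℝ => |1 - k| / 2 * Real.exp (-((1 + a) * t)) +
      |1 + k| * Real.exp (-((1 + a - |1 - a|) * t))) atTop (𝓝 (|1 - k| / 2 * 0 + |1 + k| * 0)) := by
    refine Tendsto.add (Tendsto.const_mul _ ?_) (Tendsto.const_mul _ ?_)
    · exact Real.tendsto_exp_neg_atTop_nhds_zero.comp
        (tendsto_id.const_mul_atTop (by linarith : 0 < 1 + a))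
    · exact Real.tendsto_exp_neg_atTop_nhds_zero.comp
        (tendsto_id.const_mul_atTop (by linarith : 0 < 1 + a - |1 - a|))
  simp only [mul_zero, add_zero] at hlim
  obtain ⟨Y, hY⟩ := eventually_atTop.1 (hlim.eventually_le_const (show 0 < |1 - k| / 4 by positivity))
  refine ⟨max Y 1, by positivity, |1 - k| / 8, by positivity, fun z hz => ?_⟩
  have h := hY |z.im| ((le_max_left _ _).trans hz)
  set t := |z.im| with ht
  have hs1 := le_norm_sin (z * ((1 + a : ℝ) : ℂ))
  have hs2 := norm_sin_le (z * ((1 - a : ℝ) : ℂ))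
  have e1 : |(z * ((1 + a : ℝ) : ℂ)).im| = (1 + a) * t :=
    abs_im_mul_ofReal (by linarith) z
  have e2 : |(z * ((1 - a : ℝ) : ℂ)).im| = |1 - a| * t := by
    rw [im_mul_ofReal, abs_mul, mul_comm]
  rw [e1] at hs1
  rw [e2] at hs2
  have hF : |1 - k| * ‖sin (z * ((1 + a : ℝ) : ℂ))‖ - |1 + k| * ‖sin (z * ((1 - a : ℝ) : ℂ))‖ ≤
      2 * ‖rootFun a k z‖ := by
    have h2 : 2 * ‖rootFun a k z‖ = ‖2 * rootFun a k z‖ := by rw [norm_mul, Complex.norm_two]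
    rw [h2, two_mul_rootFun]
    have := norm_sub_norm_le (((1 - k : ℝ) : ℂ) * sin (z * ((1 + a : ℝ) : ℂ)))
      (-(((1 + k : ℝ) : ℂ) * sin (z * ((1 - a : ℝ) : ℂ))))
    rw [norm_neg, sub_neg_eq_add, norm_mul, norm_mul, Complex.norm_real, Complex.norm_real] at this
    exact this
  have hE := Real.exp_pos ((1 + a) * t)
  have h3 := mul_le_mul_of_nonneg_right h hE.le
  have e3 : Real.exp (-((1 + a) * t)) * Real.exp ((1 + a) * t) = 1 := by
    rw [← Real.exp_add]; simp
  have e4 : Real.exp (-((1 + a - |1 - a|) * t)) * Real.exp ((1 + a) * t) =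
      Real.exp (|1 - a| * t) := by
    rw [← Real.exp_add]; ring_nf
  rw [add_mul, mul_assoc, mul_assoc, e3, e4] at h3
  have h4 := mul_le_mul_of_nonneg_left hs1 hA.le
  have h5 := mul_le_mul_of_nonneg_left hs2 (abs_nonneg (1 + k))
  linarith

theorem exists_nat_mul_near_int (a : ℝ) {δ : ℝ} (hδ : 0 < δ) (L : ℕ) :
    ∃ m : ℕ, L ≤ m ∧ ∃ j : ℤ, |m * a - j| ≤ δ := by
  obtain ⟨n, hn⟩ := exists_nat_gt ((L + 1) / δ)
  have hn0 : 0 < n := by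
    have : (0 : ℝ) < n := lt_of_le_of_lt (by positivity) hn
    exact_mod_cast this
  obtain ⟨q, hq0, -, hq⟩ := Real.exists_nat_abs_mul_sub_round_le a hn0
  -- Dirichlet's denominator `q` may be small; multiplying by L + 1 forces m ≥ L, and the extra
  -- error is absorbed by n > (L + 1)/δ.
  refine ⟨(L + 1) * q, by nlinarith, (L + 1) * round (q * a), ?_⟩
  have e : (((L + 1) * q : ℕ) : ℝ) * a - (((L + 1) * round (q * a) : ℤ) : ℝ) =
      (L + 1) * (q * a - round (q * a)) := by push_cast; ring
  rw [e, abs_mul, abs_of_pos (by positivity : (0 : ℝ) < L + 1)]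
  calc (L + 1 : ℝ) * |q * a - round (q * a)| ≤ (L + 1) * (1 / (n + 1)) := by gcongr
    _ ≤ δ := by
      rw [div_lt_iff₀ hδ] at hn
      rw [mul_one_div, div_le_iff₀ (by positivity)]
      nlinarith

/-- All zeros of `rootFun a k` are real. -/
def RealZeros (a k : ℝ) : Prop := ∀ z : ℂ, rootFun a k z = 0 → z.im = 0

theorem exists_real_rootFun_ne_zero {a k : ℝ} (hka : k * a ≠ 1) : ∃ x : ℝ, rootFun a k x ≠ 0 := by
  have h := (hasDerivAt_rootFun a k ((0 : ℝ) : ℂ)).comp_ofReal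
  have h0 : rootDeriv a k ((0 : ℝ) : ℂ) ≠ 0 := by
    rw [ofReal_zero, rootDeriv_zero]
    exact_mod_cast sub_ne_zero.2 hka.symm
  exact (h.eventually_ne h0 (c := 0)).exists

/-- Along arbitrarily large circles `rootFun` is bounded below by a multiple of its growth rate. -/
theorem exists_circle_le_norm_rootFun {a k : ℝ} (ha : 0 < a) (hk : k ≠ 1) (hka : k * a ≠ 1)
    (hreal : RealZeros a k) :
    ∃ c > 0, ∀ M : ℝ, ∃ R > M, ∀ w ∈ sphere (0 : ℂ) R,
      c * Real.exp ((1 + a) * |w.im|) ≤ ‖rootFun a k w‖ := by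
  obtain ⟨Y, hY, c₁, hc₁, hfar⟩ := exists_le_norm_rootFun_of_le_abs_im ha hk
  obtain ⟨x₀, hx₀⟩ := exists_real_rootFun_ne_zero hka
  -- F at height y on the line Re z = x₀, with the abscissa perturbed by u and the phase of the
  -- frequency-`a` factors by η. At u = η = 0 it never vanishes, and the tube lemma makes this
  -- uniform for |y| ≤ Y.
  let Ψ : ℝ × (ℝ × ℝ) → ℂ := fun p =>
    sin ((x₀ + p.2.1 : ℝ) + p.1 * I) * cos (((x₀ + p.2.1 : ℝ) + p.1 * I) * a + p.2.2) -
      k * (cos ((x₀ + p.2.1 : ℝ) + p.1 * I) * sin (((x₀ + p.2.1 : ℝ) + p.1 * I) * a + p.2.2))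
  have hΨ : Continuous Ψ := by
    simp only [Ψ]
    fun_prop
  have hΨ0 : ∀ y : ℝ, Ψ (y, (0, 0)) ≠ 0 := by
    intro y hy
    have h1 : rootFun a k (x₀ + y * I) = 0 := by simpa [Ψ, rootFun] using hy
    have h2 := hreal _ h1
    have h3 : y = 0 := by simpa using h2
    rw [h3] at h1
    exact hx₀ (by simpa using h1)
  obtain ⟨y₀, -, hy₀⟩ := (isCompact_Icc (a := -Y) (b := Y)).exists_isMinOn
    ⟨0, by constructor <;> linarith⟩
    (f := fun y : ℝ => ‖Ψ (y, (0, 0))‖) (Continuous.continuousOn (by fun_prop))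
  set c₂ := ‖Ψ (y₀, (0, 0))‖ / 2 with hc₂
  have hc₂0 : 0 < c₂ := half_pos (norm_pos_iff.2 (hΨ0 y₀))
  have hopen : IsOpen {p | c₂ < ‖Ψ p‖} := isOpen_lt continuous_const hΨ.norm
  have hsub : Set.Icc (-Y) Y ×ˢ {((0 : ℝ), (0 : ℝ))} ⊆ {p | c₂ < ‖Ψ p‖} := by
    rintro ⟨y, q⟩ ⟨hy, hq⟩
    obtain rfl : q = (0, 0) := hq
    have h1 : ‖Ψ (y₀, (0, 0))‖ ≤ ‖Ψ (y, (0, 0))‖ := hy₀ hy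
    simp only [Set.mem_ofPred_eq]
    linarith
  obtain ⟨U, V, -, hV, hUs, hVs, hUV⟩ :=
    generalized_tube_lemma isCompact_Icc isCompact_singleton hopen hsub
  obtain ⟨δ, hδ, hδV⟩ := Metric.isOpen_iff.1 hV (0, 0) (hVs rfl)
  have hnear : ∀ y u η : ℝ, |y| ≤ Y → |u| < δ → |η| < δ → c₂ < ‖Ψ (y, (u, η))‖ := by
    intro y u η hy hu hη
    have h1 : ((u, η) : ℝ × ℝ) ∈ ball ((0 : ℝ), (0 : ℝ)) δ := by
      rw [mem_ball, Prod.dist_eq]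
      simpa using ⟨hu, hη⟩
    exact hUV ⟨hUs (abs_le.1 hy), hδV h1⟩
  refine ⟨min c₁ (c₂ * Real.exp (-((1 + a) * Y))), by positivity, fun M => ?_⟩
  have hπ := Real.pi_pos
  obtain ⟨L, hL⟩ := exists_nat_gt (|M| + |x₀| + Y + Y ^ 2 / δ)
  obtain ⟨m, hm, j, hj⟩ := exists_nat_mul_near_int a (show 0 < δ / (4 * Real.pi) by positivity) L
  -- Translation by 2πm is an exact period in z and, as `m * a` is nearly an integer, an approximate
  -- one in az. The part of the circle with |Im w| ≤ Y lies within Y²/R < δ of the line Re w = ±R.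
  set R := x₀ + 2 * Real.pi * m with hR
  have hLm : (L : ℝ) ≤ m := by exact_mod_cast hm
  have hmR : |M| + Y + Y ^ 2 / δ < R := by
    have h1 : (m : ℝ) ≤ 2 * Real.pi * m := by
      have : (0 : ℝ) ≤ m := Nat.cast_nonneg m
      nlinarith [Real.pi_gt_three]
    have := neg_abs_le x₀
    linarith
  have hq0 : 0 ≤ Y ^ 2 / δ := by positivity
  have hR0 : 0 < R := by linarith [abs_nonneg M]
  have hYR : Y < R := by linarith [abs_nonneg M]
  have hYδ : Y ^ 2 / R < δ := by
    have : Y ^ 2 / δ < R := by linarith [abs_nonneg M]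
    rw [div_lt_iff₀ hδ] at this
    rw [div_lt_iff₀ hR0]
    linarith
  refine ⟨R, by linarith [le_abs_self M], ?_⟩
  have hpos : ∀ w ∈ sphere (0 : ℂ) R, |w.im| ≤ Y → 0 < w.re → c₂ ≤ ‖rootFun a k w‖ := by
    intro w hw hwY hre
    have hnorm : w.re ^ 2 + w.im ^ 2 = R ^ 2 := by
      have h1 : ‖w‖ = R := by simpa using hw
      have := Complex.sq_norm w
      rw [h1, normSq_apply] at this
      linarith
    have hu : |w.re - R| < δ := by
      have h1 : w.re ≤ R := by
        nlinarith [sq_nonneg w.im]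
      have h2 : w.im ^ 2 ≤ Y ^ 2 := sq_le_sq' (abs_le.1 hwY).1 (abs_le.1 hwY).2
      rw [abs_of_nonpos (by linarith)]
      refine lt_of_le_of_lt ?_ hYδ
      rw [le_div_iff₀ hR0]
      nlinarith
    have hη : |2 * Real.pi * (m * a - j)| < δ := by
      rw [abs_mul, abs_of_pos (by positivity : (0 : ℝ) < 2 * Real.pi)]
      have : 2 * Real.pi * |m * a - j| ≤ 2 * Real.pi * (δ / (4 * Real.pi)) := by gcongr
      have e : 2 * Real.pi * (δ / (4 * Real.pi)) = δ / 2 := by field_simp; norm_num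
      linarith
    have h := hnear w.im (w.re - R) _ hwY hu hη
    have e1 : (((x₀ + (w.re - R) : ℝ) : ℂ) + w.im * I) = w - m * (2 * Real.pi) := by
      rw [hR]
      conv_rhs => rw [← Complex.re_add_im w]
      push_cast
      ring
    have e2 : Ψ (w.im, (w.re - R, 2 * Real.pi * (m * a - j))) = rootFun a k w := by
      have e3 : (w - m * (2 * Real.pi)) * a + ((2 * Real.pi * (m * a - j) : ℝ) : ℂ) =
          w * a - j * (2 * Real.pi) := by push_cast; ring
      simp only [Ψ, e1, e3, rootFun, Complex.sin_sub_nat_mul_two_pi,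
        Complex.cos_sub_nat_mul_two_pi, Complex.sin_sub_int_mul_two_pi,
        Complex.cos_sub_int_mul_two_pi]
    rw [e2] at h
    exact h.le
  intro w hw
  rcases le_total Y |w.im| with h | h
  · exact (mul_le_mul_of_nonneg_right (min_le_left _ _) (Real.exp_pos _).le).trans (hfar w h)
  · have h1 : c₂ ≤ ‖rootFun a k w‖ := by
      rcases lt_trichotomy w.re 0 with hre | hre | hre
      · have := hpos (-w) (by simpa using hw) (by simpa using h) (by simpa using hre)
        rwa [rootFun_neg, norm_neg] at this
      · have h1 : ‖w‖ = R := by simpa using hw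
        have h2 : ‖w‖ ≤ |w.re| + |w.im| := Complex.norm_le_abs_re_add_abs_im w
        rw [hre, abs_zero] at h2
        linarith
      · exact hpos w hw h hre
    refine le_trans ?_ h1
    calc min c₁ (c₂ * Real.exp (-((1 + a) * Y))) * Real.exp ((1 + a) * |w.im|)
        ≤ (c₂ * Real.exp (-((1 + a) * Y))) * Real.exp ((1 + a) * Y) := by
          gcongr
          exact min_le_right _ _
      _ = c₂ := by rw [mul_assoc, ← Real.exp_add]; simp

/-! ### Partial fractions over the zeros -/

/-- All real zeros of `rootFun a k` are simple. -/
def SimpleZeros (a k : ℝ) : Prop := ∀ x : ℝ, rootFun a k x = 0 → rootDeriv a k x ≠ 0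

/-- The set of real zeros of `rootFun a k`. -/
def zeroSet (a k : ℝ) : Set ℝ := {x | rootFun a k x = 0}

theorem SimpleZeros.finite_inter {a k : ℝ} (hs : SimpleZeros a k) (R : ℝ) :
    (zeroSet a k ∩ Set.Icc (-R) R).Finite := by
  by_contra hinf
  obtain ⟨x, -, hx⟩ := Set.Infinite.exists_accPt_of_subset_isCompact hinf
    (isCompact_Icc (a := -R) (b := R)) Set.inter_subset_right
  have hfreq : ∃ᶠ y : ℝ in 𝓝[≠] x, rootFun a k y = 0 :=
    (accPt_iff_frequently_nhdsNE.1 hx).mono fun y hy => hy.1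
  have hcont : Continuous fun y : ℝ => rootFun a k y :=
    (differentiable_rootFun a k).continuous.comp continuous_ofReal
  have hx0 : rootFun a k x = 0 := by
    have hcl : IsClosed {y : ℝ | rootFun a k y = 0} := isClosed_eq hcont continuous_const
    have hmem := mem_closure_iff_frequently.2 (hfreq.filter_mono nhdsWithin_le_nhds)
    exact hcl.closure_subset hmem
  -- An accumulation point of zeros would be a zero, yet a simple zero is isolated.
  have h := ((hasDerivAt_rootFun a k x).comp_ofReal).eventually_ne (hs x hx0) (c := 0)
  exact hfreq h

/-- Partial fractions: the symmetric partial sums of the residues of an entire function of the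
same growth as `rootFun`, divided by `rootFun` and by two linear factors, converge. -/
theorem exists_tendsto_sum_residues {a k : ℝ} (ha : 0 < a) (hk : k ≠ 1) (hka : k * a ≠ 1)
    (hreal : RealZeros a k) (hs : SimpleZeros a k) :
    ∃ Z : ℕ → Finset ℝ, (∀ n, ∀ q ∈ Z n, q ∈ zeroSet a k) ∧
      (∀ q ∈ zeroSet a k, ∀ᶠ n in atTop, q ∈ Z n) ∧
      ∀ (H : ℂ → ℂ) (C : ℝ), Differentiable ℂ H →
        (∀ z, ‖H z‖ ≤ C * Real.exp ((1 + a) * |z.im|)) →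
        ∀ b₁ b₂ : ℂ, b₁ ≠ b₂ → rootFun a k b₁ ≠ 0 → rootFun a k b₂ ≠ 0 →
        Tendsto (fun n => ∑ q ∈ Z n, H q / (rootDeriv a k q * ((q - b₁) * (q - b₂)))) atTop
          (𝓝 (-(H b₁ / (rootFun a k b₁ * (b₁ - b₂)) + H b₂ / (rootFun a k b₂ * (b₂ - b₁))))) := by
  classical
  obtain ⟨c, hc, hM⟩ := exists_circle_le_norm_rootFun ha hk hka hreal
  choose R hRn hR using fun n : ℕ => hM n
  have hfin : ∀ n, (zeroSet a k ∩ Set.Ioo (-R n) (R n)).Finite := fun n =>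
    (hs.finite_inter (R n)).subset (Set.inter_subset_inter_right _ Set.Ioo_subset_Icc_self)
  have hRtop : Tendsto R atTop atTop :=
    tendsto_atTop_mono (fun n => (hRn n).le) tendsto_natCast_atTop_atTop
  have hmem : ∀ n q, q ∈ (hfin n).toFinset ↔ rootFun a k q = 0 ∧ |q| < R n := by
    intro n q
    rw [Set.Finite.mem_toFinset, abs_lt]
    rfl
  refine ⟨fun n => (hfin n).toFinset, fun n q hq => ((hmem n q).1 hq).1, fun q hq => ?_, ?_⟩
  · filter_upwards [hRtop.eventually_gt_atTop |q|] with n hn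
    exact (hmem n q).2 ⟨hq, hn⟩
  intro H C hH hHC b₁ b₂ hb hb₁ hb₂
  have hC : 0 ≤ C := by
    have := (norm_nonneg _).trans (hHC 0)
    simpa using this
  set ρ := H b₁ / (rootFun a k b₁ * (b₁ - b₂)) + H b₂ / (rootFun a k b₂ * (b₂ - b₁)) with hρ
  set T := fun n => ∑ q ∈ (hfin n).toFinset, H q / (rootDeriv a k q * ((q - b₁) * (q - b₂))) with hT
  suffices hlim : Tendsto (fun n => T n + ρ) atTop (𝓝 0) by
    have := hlim.sub_const ρ
    simpa using this
  set D : ℂ → ℂ := fun z => rootFun a k z * ((z - b₁) * (z - b₂)) with hD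
  have hDd : ∀ z, HasDerivAt D (rootDeriv a k z * ((z - b₁) * (z - b₂)) +
      rootFun a k z * (1 * (z - b₂) + (z - b₁) * 1)) z := fun z =>
    (hasDerivAt_rootFun a k z).mul (((hasDerivAt_id z).sub_const b₁).mul
      ((hasDerivAt_id z).sub_const b₂))
  have hne : ∀ q : ℝ, rootFun a k q = 0 → ((q : ℂ) - b₁ ≠ 0 ∧ (q : ℂ) - b₂ ≠ 0) := fun q hq =>
    ⟨fun h => hb₁ (sub_eq_zero.1 h ▸ hq), fun h => hb₂ (sub_eq_zero.1 h ▸ hq)⟩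
  have key : ∀ᶠ n in atTop, ‖T n + ρ‖ ≤ 4 * C / c / R n := by
    filter_upwards [hRtop.eventually_gt_atTop (2 * ‖b₁‖), hRtop.eventually_gt_atTop (2 * ‖b₂‖),
      hRtop.eventually_gt_atTop 0] with n hn₁ hn₂ hn₀
    have hsph : ∀ w ∈ sphere (0 : ℂ) (R n), rootFun a k w ≠ 0 := fun w hw h => by
      have h1 := hR n w hw
      rw [h, norm_zero] at h1
      have : 0 < c * Real.exp ((1 + a) * |w.im|) := by positivity
      linarith
    set Z := (hfin n).toFinset.image (fun q : ℝ => (q : ℂ)) with hZ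
    have hZmem : ∀ z : ℂ, z ∈ Z ↔ ∃ q : ℝ, (rootFun a k q = 0 ∧ |q| < R n) ∧ (q : ℂ) = z := by
      intro z
      simp only [hZ, Finset.mem_image, hmem]
    have h12 : b₁ ∉ insert b₂ Z := by
      rw [Finset.mem_insert, hZmem]
      rintro (h | ⟨q, hq, h⟩)
      · exact hb h
      · exact hb₁ (h ▸ hq.1)
    have h2 : b₂ ∉ Z := by
      rw [hZmem]
      rintro ⟨q, hq, h⟩
      exact hb₂ (h ▸ hq.1)
    have hres := circleIntegral_div_eq_sum hn₀ (insert b₁ (insert b₂ Z)) (D := D) (H := H)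
      (fun z => (hDd z).differentiableAt) hH ?_ ?_ ?_
    · have hsum : ∑ s ∈ insert b₁ (insert b₂ Z), H s / deriv D s = T n + ρ := by
        rw [Finset.sum_insert h12, Finset.sum_insert h2, hZ,
          Finset.sum_image (fun x _ y _ h => ofReal_injective h), hρ, hT]
        have e : ∀ q ∈ (hfin n).toFinset, H q / deriv D q =
            H q / (rootDeriv a k q * ((q - b₁) * (q - b₂))) := by
          intro q hq
          rw [(hDd q).deriv, ((hmem n q).1 hq).1, zero_mul, add_zero]
        rw [Finset.sum_congr rfl e, (hDd b₁).deriv, (hDd b₂).deriv]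
        simp only [sub_self, zero_mul, mul_zero, one_mul, mul_one, add_zero, zero_add]
        ring
      rw [hsum] at hres
      have hbound := circleIntegral.norm_two_pi_i_inv_smul_integral_le_of_norm_le_const
        -- Both linear factors are at least R/2 in modulus on the circle, hence the 4/R²; the
        -- exponentials cancel, and the length of the circle leaves O(1/R).
        (f := fun z => H z / D z) (c := (0 : ℂ)) (C := 4 * C / c / R n ^ 2) hn₀.le ?_
      · rw [hres, smul_eq_mul, inv_mul_cancel_left₀ Complex.two_pi_I_ne_zero] at hbound
        refine hbound.trans (le_of_eq ?_)
        field_simp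
      · intro z hz
        have hzR : ‖z‖ = R n := by simpa using hz
        have h1 : R n / 2 ≤ ‖z - b₁‖ := by
          have := norm_sub_norm_le z b₁
          linarith
        have h2 : R n / 2 ≤ ‖z - b₂‖ := by
          have := norm_sub_norm_le z b₂
          linarith
        have h3 := hR n z hz
        have hE := Real.exp_pos ((1 + a) * |z.im|)
        rw [norm_div, hD]
        simp only [norm_mul]
        calc ‖H z‖ / (‖rootFun a k z‖ * (‖z - b₁‖ * ‖z - b₂‖))
            ≤ (C * Real.exp ((1 + a) * |z.im|)) /
              ((c * Real.exp ((1 + a) * |z.im|)) * (R n / 2 * (R n / 2))) := by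
              gcongr
              exact hHC z
          _ = 4 * C / c / R n ^ 2 := by field_simp; ring
    · intro z hz
      rw [Finset.mem_insert, Finset.mem_insert, hZmem, hD]
      simp only [mul_eq_zero, sub_eq_zero]
      constructor
      · rintro (h | h | h)
        · right; right
          have hzre : ((z.re : ℝ) : ℂ) = z := Complex.ext rfl (by simp [hreal z h])
          refine ⟨z.re, ⟨by rw [hzre]; exact h, ?_⟩, hzre⟩
          have hzn : |z.re| = ‖z‖ := by rw [← hzre, Complex.norm_real]; simp
          rw [hzn]
          refine lt_of_le_of_ne (by simpa using hz) fun h' => hsph z (by simpa using h') h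
        · exact Or.inl h
        · exact Or.inr (Or.inl h)
      · rintro (h | h | ⟨q, hq, rfl⟩)
        · exact Or.inr (Or.inl h)
        · exact Or.inr (Or.inr h)
        · exact Or.inl hq.1
    · intro z hz
      rw [Finset.mem_insert, Finset.mem_insert, hZmem] at hz
      rw [mem_ball_zero_iff]
      rcases hz with rfl | rfl | ⟨q, hq, rfl⟩
      · linarith [norm_nonneg z]
      · linarith [norm_nonneg z]
      · rw [Complex.norm_real]; exact hq.2
    · intro z hz
      rw [Finset.mem_insert, Finset.mem_insert, hZmem] at hz
      rw [(hDd z).deriv]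
      rcases hz with rfl | rfl | ⟨q, hq, rfl⟩
      · simpa using ⟨hb₁, sub_ne_zero.2 hb⟩
      · simpa using ⟨hb₂, sub_ne_zero.2 hb.symm⟩
      · rw [hq.1, zero_mul, add_zero]
        exact mul_ne_zero (hs q hq.1) (mul_ne_zero (hne q hq.1).1 (hne q hq.1).2)
  exact squeeze_zero_norm' key (tendsto_const_nhds.div_atTop hRtop)

/-- Once the family is summable, its sum can be computed along any exhaustion by finite sets. -/
theorem hasSum_subtype_of_tendsto {S : Set ℝ} {Z : ℕ → Finset ℝ} (hZS : ∀ n, ∀ q ∈ Z n, q ∈ S)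
    (hSZ : ∀ q ∈ S, ∀ᶠ n in atTop, q ∈ Z n) {f : ℝ → ℝ} {L : ℝ}
    (hf : Summable fun q : S => f q) (hL : Tendsto (fun n => ∑ q ∈ Z n, f q) atTop (𝓝 L)) :
    HasSum (fun q : S => f q) L := by
  classical
  have htop : Tendsto (fun n => (Z n).subtype (· ∈ S)) atTop atTop := by
    refine tendsto_atTop.2 fun u => ?_
    have : ∀ᶠ n in atTop, ∀ q ∈ u, (q : ℝ) ∈ Z n :=
      (Filter.eventually_all_finset u).2 fun q _ => hSZ q q.2
    filter_upwards [this] with n hn q hq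
    exact Finset.mem_subtype.2 (hn q hq)
  have h1 := hf.hasSum.comp htop
  have h2 : ∀ n, ∑ q ∈ (Z n).subtype (· ∈ S), f q = ∑ q ∈ Z n, f q := fun n =>
    Finset.sum_subtype_of_mem f (hZS n)
  have h3 : Tendsto (fun n => ∑ q ∈ Z n, f q) atTop (𝓝 (∑' q : S, f q)) := by
    refine h1.congr fun n => ?_
    exact h2 n
  rw [tendsto_nhds_unique hL h3]
  exact hf.hasSum

theorem I_sq_add (q b : ℂ) : (q - b * I) * (q - -(b * I)) = q ^ 2 + b ^ 2 := by
  linear_combination (-b ^ 2) * I_sq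

/-- With H = F' every residue quotient H/F' is 1, so the choice b = ±i turns the convergent sums
into sums of the positive terms 1/(q² + 1), which are therefore bounded. -/
theorem summable_inv_sq_add_one {a k : ℝ} (ha : 0 < a) (hk : k ≠ 1) (hka : k * a ≠ 1)
    (hreal : RealZeros a k) (hs : SimpleZeros a k) :
    Summable fun q : zeroSet a k => 1 / ((q : ℝ) ^ 2 + 1) := by
  classical
  obtain ⟨Z, hZS, hSZ, hlim⟩ := exists_tendsto_sum_residues ha hk hka hreal hs
  have hI : rootFun a k (1 * I) ≠ 0 := fun h => by simpa using hreal _ h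
  have hI' : rootFun a k (-(1 * I)) ≠ 0 := fun h => by simpa using hreal _ h
  have h := hlim (rootDeriv a k) _ (differentiable_rootDeriv a k) (norm_rootDeriv_le ha k)
    (1 * I) (-(1 * I)) (fun h => by have := congrArg Complex.im h; norm_num at this) hI hI'
  have hre := (continuous_re.tendsto _).comp h
  obtain ⟨B, hB⟩ := hre.bddAbove_range
  refine summable_of_sum_le (c := B) (fun q => by positivity) fun u => ?_
  have hev : ∀ᶠ n in atTop, ∀ q ∈ u, (q : ℝ) ∈ Z n :=
    (Filter.eventually_all_finset u).2 fun q _ => hSZ q q.2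
  obtain ⟨n, hn⟩ := hev.exists
  refine le_trans ?_ (hB ⟨n, rfl⟩)
  have e : ∀ q ∈ Z n, rootDeriv a k q / (rootDeriv a k q * ((q - 1 * I) * (q - -(1 * I)))) =
      ((1 / (q ^ 2 + 1) : ℝ) : ℂ) := by
    intro q hq
    have h1 := hs q (hZS n q hq)
    rw [I_sq_add, ← div_div, div_self h1]
    push_cast
    ring
  simp only [Function.comp]
  rw [Finset.sum_congr rfl e, ← ofReal_sum, ofReal_re]
  have e2 : ∑ q ∈ u, 1 / ((q : ℝ) ^ 2 + 1) =
      ∑ x ∈ u.map (Function.Embedding.subtype _), 1 / (x ^ 2 + 1) := by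
    rw [Finset.sum_map]; rfl
  rw [e2]
  refine Finset.sum_le_sum_of_subset_of_nonneg ?_ fun _ _ _ => by positivity
  intro x hx
  obtain ⟨q, hq, rfl⟩ := Finset.mem_map.1 hx
  exact hn q hq

end ComplexAnalysis

/-! ### The Laguerre inequality on the real line -/

open Metric Filter Topology

/-- The restriction of `rootFun` to the real line. -/
noncomputable def realRootFun (a k x : ℝ) : ℝ :=
  Real.sin x * Real.cos (x * a) - k * (Real.cos x * Real.sin (x * a))

/-- The restriction of `rootDeriv` to the real line. -/
noncomputable def realRootDeriv (a k x : ℝ) : ℝ :=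
  (1 - k * a) * (Real.cos (x * a) * Real.cos x) - (a - k) * (Real.sin (x * a) * Real.sin x)

theorem rootFun_ofReal (a k x : ℝ) : rootFun a k x = (realRootFun a k x : ℝ) := by
  simp only [rootFun, realRootFun]; push_cast; rfl

theorem rootDeriv_ofReal (a k x : ℝ) : rootDeriv a k x = (realRootDeriv a k x : ℝ) := by
  simp only [rootDeriv, realRootDeriv]; push_cast; rfl

theorem rootFun_ofReal_eq_zero {a k x : ℝ} : rootFun a k x = 0 ↔ realRootFun a k x = 0 := by
  rw [rootFun_ofReal, Complex.ofReal_eq_zero]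

theorem rootDeriv_ofReal_eq_zero {a k x : ℝ} : rootDeriv a k x = 0 ↔ realRootDeriv a k x = 0 := by
  rw [rootDeriv_ofReal, Complex.ofReal_eq_zero]

theorem hasDerivAt_realRootFun (a k x : ℝ) :
    HasDerivAt (realRootFun a k) (realRootDeriv a k x) x := by
  have h := (hasDerivAt_rootFun a k x).real_of_complex
  simpa only [rootFun_ofReal, rootDeriv_ofReal, Complex.ofReal_re] using h

/-- The second derivative of `realRootFun`. -/
noncomputable def realRootDeriv₂ (a k x : ℝ) : ℝ :=
  -(1 - 2 * (k * a) + a ^ 2) * (Real.sin x * Real.cos (x * a)) -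
    (2 * a - k - k * a ^ 2) * (Real.cos x * Real.sin (x * a))

theorem hasDerivAt_realRootDeriv (a k x : ℝ) :
    HasDerivAt (realRootDeriv a k) (realRootDeriv₂ a k x) x := by
  have h0 : HasDerivAt (fun x : ℝ => x * a) a x := by
    simpa using (hasDerivAt_id x).mul_const a
  refine (((h0.cos.mul (Real.hasDerivAt_cos x)).const_mul (1 - k * a)).sub
    ((h0.sin.mul (Real.hasDerivAt_sin x)).const_mul (a - k))).congr_deriv ?_
  simp only [realRootDeriv₂]
  ring

/-- The Laguerre inequality for the real entire function `rootFun` with only real zeros. -/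
theorem laguerre {a k : ℝ} (ha : 0 < a) (hk : k ≠ 1) (hka : k * a ≠ 1)
    (hreal : RealZeros a k) (hs : SimpleZeros a k) {x : ℝ} (hx : realRootFun a k x ≠ 0) :
    0 ≤ realRootDeriv a k x ^ 2 - realRootFun a k x * realRootDeriv₂ a k x := by
  obtain ⟨Z, hZS, -, hlim⟩ := exists_tendsto_sum_residues ha hk hka hreal hs
  set f := realRootFun a k with hf
  set g := realRootDeriv a k with hg
  have hcont : Continuous f :=
    continuous_iff_continuousAt.2 fun y => (hasDerivAt_realRootFun a k y).continuousAt
  obtain ⟨δ, hδ, hδ0⟩ := Metric.isOpen_iff.1 (isOpen_ne_fun hcont continuous_const) x hx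
  have hL := (hasDerivAt_realRootDeriv a k x).div (hasDerivAt_realRootFun a k x) hx
  have hsl := hasDerivAt_iff_tendsto_slope.1 hL
  have hle : ∀ᶠ y in 𝓝[≠] x, slope (g / f) x y ≤ 0 := by
    have h1 : ∀ᶠ y in 𝓝[≠] x, y ∈ ball x δ := nhdsWithin_le_nhds (ball_mem_nhds x hδ)
    filter_upwards [h1, self_mem_nhdsWithin] with y hy hyx
    have hyx : y ≠ x := hyx
    have hy0 : f y ≠ 0 := hδ0 hy
    have h := hlim (rootDeriv a k) _ (differentiable_rootDeriv a k) (norm_rootDeriv_le ha k)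
      y x (by exact_mod_cast hyx) (fun h => hy0 (rootFun_ofReal_eq_zero.1 h))
      (fun h => hx (rootFun_ofReal_eq_zero.1 h))
    have hre := (Complex.continuous_re.tendsto _).comp h
    -- With H = F', b₁ = y, b₂ = x, the sum of 1/((q - y)(q - x)) is minus the difference quotient
    -- of F'/F. No zero lies within δ of x, so x and y are on the same side of each q and all terms
    -- are nonnegative; letting y → x gives (F'/F)' ≤ 0.
    have e : (-(rootDeriv a k y / (rootFun a k y * ((y : ℂ) - x)) +
        rootDeriv a k x / (rootFun a k x * ((x : ℂ) - y)))).re = -slope (g / f) x y := by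
      have h2 : y - x ≠ 0 := sub_ne_zero.2 hyx
      have h3 : x - y ≠ 0 := sub_ne_zero.2 hyx.symm
      simp only [rootFun_ofReal, rootDeriv_ofReal]
      norm_cast
      rw [← hf, ← hg, slope_def_field, Pi.div_apply, Pi.div_apply, neg_inj,
        show x - y = -(y - x) by ring]
      field_simp
      ring
    rw [e] at hre
    have hnn : 0 ≤ -slope (g / f) x y := by
      refine ge_of_tendsto' hre fun n => ?_
      simp only [Function.comp]
      rw [Complex.re_sum]
      refine Finset.sum_nonneg fun q hq => ?_
      have hq0 : f q = 0 := rootFun_ofReal_eq_zero.1 (hZS n q hq)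
      have h1 := hs q (hZS n q hq)
      rw [← div_div, div_self h1]
      norm_cast
      have hqx : δ ≤ |q - x| := by
        by_contra! hlt
        exact hδ0 (by rw [mem_ball, Real.dist_eq]; exact hlt) hq0
      rw [mem_ball, Real.dist_eq] at hy
      apply one_div_nonneg.2
      rcases abs_lt.1 hy with ⟨hy1, hy2⟩
      rcases le_abs.1 hqx with h | h
      · exact mul_nonneg (by linarith) (by linarith)
      · exact mul_nonneg_of_nonpos_of_nonpos (by linarith) (by linarith)
    linarith
  have h := le_of_tendsto hsl hle
  rw [div_nonpos_iff] at h
  have hpos : 0 < f x ^ 2 := by positivity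
  rcases h with h | h
  · linarith [h.2]
  · have := h.1
    nlinarith

/-! ### Boundedness of the residues -/

theorem exists_int_abs_cos_lt {θ : ℝ} (hθ : Irrational θ) {δ : ℝ} (hδ : 0 < δ) :
    ∃ n : ℤ, |Real.cos (n * Real.pi * θ)| < δ := by
  have hd : Dense (AddSubgroup.closure {θ, 1} : Set ℝ) :=
    dense_addSubgroupClosure_pair_iff.2 (by simpa using hθ)
  have ho : IsOpen {t : ℝ | |Real.cos (t * Real.pi)| < δ} :=
    isOpen_lt (by fun_prop) continuous_const
  -- Some nθ + m approximates 1/2, a zero of cos(πt); the integer `m` only changes the sign of the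
  -- cosine.
  obtain ⟨t, ht, htδ⟩ := hd.exists_mem_open ho ⟨1 / 2, by
    change |Real.cos (1 / 2 * Real.pi)| < δ
    rw [show 1 / 2 * Real.pi = Real.pi / 2 by ring, Real.cos_pi_div_two]; simpa using hδ⟩
  obtain ⟨n, m, rfl⟩ := AddSubgroup.mem_closure_pair.1 ht
  refine ⟨n, ?_⟩
  have htδ : |Real.cos ((n • θ + m • (1 : ℝ)) * Real.pi)| < δ := htδ
  have e : (n • θ + m • (1 : ℝ)) * Real.pi = n * Real.pi * θ + m * Real.pi := by
    simp only [zsmul_eq_mul]; ring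
  rw [e, Real.cos_add_int_mul_pi, abs_mul] at htδ
  simpa using htδ

theorem exists_pos_sq_lt {A B : ℝ} (hA : 0 ≤ A) (hB : 0 < B) :
    ∃ δ > 0, ∀ C S : ℝ, |C| < δ → S ^ 2 + C ^ 2 = 1 → S ≠ 0 ∧ A * C ^ 2 < B * S ^ 2 := by
  refine ⟨Real.sqrt (B / (A + B)), Real.sqrt_pos.2 (by positivity), fun C S hC hS => ?_⟩
  have h1 : C ^ 2 < B / (A + B) := by
    rw [← sq_abs]
    exact (Real.lt_sqrt (abs_nonneg _)).1 hC
  rw [lt_div_iff₀ (by positivity)] at h1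
  have h2 : A * C ^ 2 < B * S ^ 2 := by nlinarith
  refine ⟨fun h => ?_, h2⟩
  rw [h] at h2
  have := mul_nonneg hA (sq_nonneg C)
  nlinarith

/-- For irrational `a` the Laguerre inequality is violated at a point where one sine vanishes and
the other cosine is tiny: x = nπ if k < a and ka < 1, x = nπ/a if k > a and ka > 1. -/
theorem not_irrational_of_realZeros {a k : ℝ} (ha : 0 < a) (hk : k ≠ 1) (hka : k * a ≠ 1)
    (hreal : RealZeros a k) (hs : SimpleZeros a k) (hpos : 0 < k * (a - k) * (1 - k * a)) :
    ¬ Irrational a := by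
  intro hirr
  have hk0 : 0 < k := by
    by_contra! h
    have h1 : 0 ≤ (a - k) * (1 - k * a) := mul_nonneg (by linarith) (by nlinarith)
    nlinarith
  have hprod : 0 < (a - k) * (1 - k * a) := by
    rw [mul_assoc] at hpos
    exact pos_of_mul_pos_right hpos hk0.le
  rcases pos_and_pos_or_neg_and_neg_of_mul_pos hprod with ⟨h1, h2⟩ | ⟨h1, h2⟩
  · have hB : 0 < k * (2 * a - k - k * a ^ 2) := by
      -- 2a - k - ka² = (a - k) + a(1 - ka).
      apply mul_pos hk0; nlinarith
    obtain ⟨δ, hδ, hδ'⟩ := exists_pos_sq_lt (sq_nonneg (1 - k * a)) hB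
    obtain ⟨n, hn⟩ := exists_int_abs_cos_lt hirr hδ
    obtain ⟨hS, hlt⟩ := hδ' _ _ hn (Real.sin_sq_add_cos_sq _)
    have hs0 : Real.sin (n * Real.pi) = 0 := Real.sin_int_mul_pi n
    have hc0 : Real.cos (n * Real.pi) ^ 2 = 1 := by
      have := Real.sin_sq_add_cos_sq (n * Real.pi)
      rw [hs0] at this
      linarith
    have hc1 : Real.cos (n * Real.pi) ≠ 0 := fun h => by rw [h] at hc0; norm_num at hc0
    have hL := laguerre ha hk hka hreal hs (x := n * Real.pi) (by
      rw [realRootFun, hs0, zero_mul, zero_sub, neg_ne_zero]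
      exact mul_ne_zero hk0.ne' (mul_ne_zero hc1 hS))
    simp only [realRootFun, realRootDeriv, realRootDeriv₂, hs0] at hL
    set C := Real.cos (n * Real.pi * a)
    set S := Real.sin (n * Real.pi * a)
    have e : 0 ≤ Real.cos (n * Real.pi) ^ 2 *
        ((1 - k * a) ^ 2 * C ^ 2 - k * (2 * a - k - k * a ^ 2) * S ^ 2) := by
      refine hL.trans (le_of_eq ?_)
      ring
    rw [hc0] at e
    linarith
  -- 2ka - 1 - a² = (ka - 1) + a(k - a).
  · have hB : 0 < 2 * (k * a) - 1 - a ^ 2 := by nlinarith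
    obtain ⟨δ, hδ, hδ'⟩ := exists_pos_sq_lt (sq_nonneg (1 - k * a)) hB
    obtain ⟨n, hn⟩ := exists_int_abs_cos_lt hirr.inv hδ
    obtain ⟨hS, hlt⟩ := hδ' _ _ hn (Real.sin_sq_add_cos_sq _)
    have hxa : n * Real.pi * a⁻¹ * a = n * Real.pi := by field_simp
    have hs0 : Real.sin (n * Real.pi) = 0 := Real.sin_int_mul_pi n
    have hc0 : Real.cos (n * Real.pi) ^ 2 = 1 := by
      have := Real.sin_sq_add_cos_sq (n * Real.pi)
      rw [hs0] at this
      linarith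
    have hc1 : Real.cos (n * Real.pi) ≠ 0 := fun h => by rw [h] at hc0; norm_num at hc0
    have hL := laguerre ha hk hka hreal hs (x := n * Real.pi * a⁻¹) (by
      rw [realRootFun, hxa, hs0, mul_zero, mul_zero, sub_zero]
      exact mul_ne_zero hS hc1)
    simp only [realRootFun, realRootDeriv, realRootDeriv₂, hxa, hs0] at hL
    set C := Real.cos (n * Real.pi * a⁻¹)
    set S := Real.sin (n * Real.pi * a⁻¹)
    have e : 0 ≤ Real.cos (n * Real.pi) ^ 2 *
        ((1 - k * a) ^ 2 * C ^ 2 - (2 * (k * a) - 1 - a ^ 2) * S ^ 2) := by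
      refine hL.trans (le_of_eq ?_)
      ring
    rw [hc0] at e
    linarith

/-- Multiplying F'(q) by (1 - ka) cos(aq) cos q and using F(q) = 0 yields a square minus k(a - k)(1
- ka) times a square; the sign hypothesis lets the latter be dropped. -/
theorem mul_cos_mul_cos_le_of_rootFun_eq_zero {a k : ℝ} (hle : k * (a - k) * (1 - k * a) ≤ 0)
    {q : ℝ} (hq : realRootFun a k q = 0) :
    |1 - k * a| * |Real.cos (q * a) * Real.cos q| ≤ |realRootDeriv a k q| := by
  set N := Real.cos (q * a) * Real.cos q with hN
  have hroot : Real.sin q * Real.cos (q * a) = k * (Real.cos q * Real.sin (q * a)) :=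
    sub_eq_zero.1 hq
  have e : (1 - k * a) * realRootDeriv a k q * N = ((1 - k * a) * N) ^ 2 -
      k * (a - k) * (1 - k * a) * (Real.cos q * Real.sin (q * a)) ^ 2 := by
    rw [realRootDeriv, hN]
    linear_combination (-(1 - k * a) * (a - k) * Real.sin (q * a) * Real.cos q) * hroot
  have h1 : ((1 - k * a) * N) ^ 2 ≤ (1 - k * a) * realRootDeriv a k q * N := by
    have := mul_nonneg_of_nonpos_of_nonpos hle
      (neg_nonpos.2 (sq_nonneg (Real.cos q * Real.sin (q * a))))
    rw [e]; linarith
  rw [← abs_mul]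
  by_cases h0 : (1 - k * a) * N = 0
  · rw [h0, abs_zero]; exact abs_nonneg _
  · have h2 : |(1 - k * a) * N| * |(1 - k * a) * N| ≤ |realRootDeriv a k q| * |(1 - k * a) * N| := by
      rw [← abs_mul, ← abs_mul, ← sq, abs_of_nonneg (sq_nonneg _)]
      refine le_trans (h1.trans (le_of_eq ?_)) (le_abs_self _)
      ring
    exact le_of_mul_le_mul_right h2 (abs_pos.2 h0)

/-- For rational `a`, F and F' share the period 2π times the denominator, so the minimum of |F'|
over the zeros in one compact period is attained and positive. -/
theorem exists_le_of_rational {a k : ℝ} (hs : SimpleZeros a k) (hrat : ¬ Irrational a) :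
    ∃ c > 0, ∀ q, realRootFun a k q = 0 → c ≤ |realRootDeriv a k q| := by
  obtain ⟨r, rfl⟩ := not_not.1 hrat
  set T : ℝ := 2 * Real.pi * r.den with hT
  have hT0 : 0 < T := by have := r.den_pos; have := Real.pi_pos; positivity
  have hper : Function.Periodic (fun x => (realRootFun r k x, realRootDeriv r k x)) T := by
    intro x
    have h1 : x + T = x + r.den * (2 * Real.pi) := by rw [hT]; ring
    have h2 : (x + T) * r = x * r + r.num * (2 * Real.pi) := by
      have h3 : (r : ℝ) * r.den = r.num := by exact_mod_cast Rat.mul_den_eq_num r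
      rw [hT]
      linear_combination (2 * Real.pi) * h3
    simp only [realRootFun, realRootDeriv, h2]
    simp only [h1, Real.sin_add_nat_mul_two_pi, Real.cos_add_nat_mul_two_pi,
      Real.sin_add_int_mul_two_pi, Real.cos_add_int_mul_two_pi]
  have hcont : Continuous (realRootFun (r : ℝ) k) :=
    continuous_iff_continuousAt.2 fun y => (hasDerivAt_realRootFun _ k y).continuousAt
  have hcont' : Continuous (realRootDeriv (r : ℝ) k) :=
    continuous_iff_continuousAt.2 fun y => (hasDerivAt_realRootDeriv _ k y).continuousAt
  have hcomp : IsCompact (Set.Icc 0 T ∩ {x | realRootFun r k x = 0}) :=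
    isCompact_Icc.inter_right (isClosed_eq hcont continuous_const)
  obtain ⟨x₀, hx₀, hmin⟩ := hcomp.exists_isMinOn
    ⟨0, ⟨le_rfl, hT0.le⟩, by simp [realRootFun]⟩ hcont'.abs.continuousOn
  refine ⟨|realRootDeriv r k x₀|, abs_pos.2 fun h => ?_, fun q hq => ?_⟩
  · exact hs x₀ (rootFun_ofReal_eq_zero.2 hx₀.2) (rootDeriv_ofReal_eq_zero.2 h)
  · obtain ⟨y, hy, hqy⟩ := hper.exists_mem_Ico₀ hT0 q
    obtain ⟨h1, h2⟩ := Prod.mk.inj hqy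
    rw [h2]
    exact hmin ⟨Set.Ico_subset_Icc_self hy, h1.symm.trans hq⟩

/-- The residues of `cos z cos (a z) / rootFun a k z` are bounded. -/
theorem exists_cos_mul_cos_le {a k : ℝ} (ha : 0 < a) (hk : k ≠ 1) (hka : k * a ≠ 1)
    (hreal : RealZeros a k) (hs : SimpleZeros a k) :
    ∃ C ≥ 0, ∀ q, realRootFun a k q = 0 →
      |Real.cos (q * a) * Real.cos q / realRootDeriv a k q| ≤ C := by
  rcases le_or_gt (k * (a - k) * (1 - k * a)) 0 with h | h
  · refine ⟨|1 - k * a|⁻¹, by positivity, fun q hq => ?_⟩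
    have h0 : 0 < |1 - k * a| := abs_pos.2 (sub_ne_zero.2 hka.symm)
    have h1 : 0 < |realRootDeriv a k q| := abs_pos.2 fun h' =>
      hs q (rootFun_ofReal_eq_zero.2 hq) (rootDeriv_ofReal_eq_zero.2 h')
    have h2 := mul_cos_mul_cos_le_of_rootFun_eq_zero h hq
    rw [abs_div, div_le_iff₀ h1, inv_mul_eq_div, le_div_iff₀ h0]
    linarith
  · obtain ⟨c, hc, hcq⟩ := exists_le_of_rational hs
      (not_irrational_of_realZeros ha hk hka hreal hs h)
    refine ⟨1 / c, by positivity, fun q hq => ?_⟩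
    rw [abs_div]
    refine div_le_div₀ zero_le_one ?_ hc (hcq q hq)
    rw [abs_mul]
    exact mul_le_one₀ (Real.abs_cos_le_one _) (abs_nonneg _) (Real.abs_cos_le_one _)

/-! ### Evaluation of the series and infinitude of the roots -/

/-- The positive zeros of `rootFun a k` at which neither cosine vanishes. -/
def posZeros (a k : ℝ) : Set ℝ :=
  {q | 0 < q ∧ Real.cos q ≠ 0 ∧ Real.cos (q * a) ≠ 0 ∧ realRootFun a k q = 0}

/-- The summand of the series over `posZeros a k` at the parameter `s ^ 2`. -/
noncomputable def zeroTerm (a k s q : ℝ) : ℝ :=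
  Real.cos (q * a) * Real.cos q / ((1 + q ^ 2 / s ^ 2) * realRootDeriv a k q)

/-- The value of `-I * rootFun a k (s * I)`. -/
noncomputable def hypRootFun (a k s : ℝ) : ℝ :=
  Real.sinh s * Real.cosh (s * a) - k * (Real.cosh s * Real.sinh (s * a))

theorem rootFun_mul_I (a k s : ℝ) : rootFun a k (s * Complex.I) = hypRootFun a k s * Complex.I := by
  have e : (s : ℂ) * Complex.I * a = (s * a : ℂ) * Complex.I := by ring
  simp only [rootFun, e, Complex.sin_mul_I, Complex.cos_mul_I, hypRootFun]
  push_cast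
  ring

theorem rootFun_neg_mul_I (a k s : ℝ) :
    rootFun a k (-(s * Complex.I)) = -(hypRootFun a k s * Complex.I) := by
  rw [rootFun_neg, rootFun_mul_I]

theorem cos_mul_cos_mul_I (a s : ℝ) :
    Complex.cos (s * Complex.I * a) * Complex.cos (s * Complex.I) =
      ((Real.cosh (s * a) * Real.cosh s : ℝ) : ℂ) := by
  have e : (s : ℂ) * Complex.I * a = (s * a : ℂ) * Complex.I := by ring
  simp only [e, Complex.cos_mul_I]
  push_cast
  ring

theorem RealZeros.hypRootFun_ne_zero {a k : ℝ} (hreal : RealZeros a k) {s : ℝ} (hs : 0 < s) :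
    hypRootFun a k s ≠ 0 := by
  intro h
  have h1 : rootFun a k (s * Complex.I) = 0 := by rw [rootFun_mul_I, h]; simp
  have h2 := hreal _ h1
  simp at h2
  exact hs.ne' h2

theorem zeroTerm_neg (a k s q : ℝ) : zeroTerm a k s (-q) = zeroTerm a k s q := by
  have h : realRootDeriv a k (-q) = realRootDeriv a k q := by
    simp only [realRootDeriv, neg_mul, Real.sin_neg, Real.cos_neg, mul_neg, neg_neg]
  simp only [zeroTerm, h, neg_mul, Real.cos_neg, neg_sq]

theorem abs_zeroTerm_le {a k s q C : ℝ} (hs : 0 < s)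
    (h : |Real.cos (q * a) * Real.cos q / realRootDeriv a k q| ≤ C) :
    |zeroTerm a k s q| ≤ C * (s ^ 2 + 1) * (1 / (q ^ 2 + 1)) ∧ |zeroTerm a k s q| ≤ C := by
  have hC : 0 ≤ C := (abs_nonneg _).trans h
  have e : zeroTerm a k s q =
      Real.cos (q * a) * Real.cos q / realRootDeriv a k q * (1 / (1 + q ^ 2 / s ^ 2)) := by
    rw [zeroTerm, mul_comm (1 + q ^ 2 / s ^ 2), ← div_div]; ring
  have hp : 0 < 1 / (1 + q ^ 2 / s ^ 2) := by positivity
  rw [e, abs_mul, abs_of_pos hp]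
  constructor
  · rw [mul_assoc]
    refine mul_le_mul h ?_ hp.le hC
    have e2 : 1 / (1 + q ^ 2 / s ^ 2) = s ^ 2 / (s ^ 2 + q ^ 2) := by field_simp
    rw [e2, mul_one_div, div_le_div_iff₀ (by positivity) (by positivity)]
    nlinarith [sq_nonneg q, sq_nonneg (s ^ 2)]
  · calc _ ≤ C * 1 := by
          refine mul_le_mul h ?_ hp.le hC
          rw [div_le_one (by positivity)]
          have : 0 ≤ q ^ 2 / s ^ 2 := by positivity
          linarith
      _ = C := mul_one C

theorem hasSum_zeroTerm {a k : ℝ} (ha : 0 < a) (hk : k ≠ 1) (hka : k * a ≠ 1)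
    (hreal : RealZeros a k) (hs : SimpleZeros a k) {s : ℝ} (hs0 : 0 < s) :
    HasSum (fun q : zeroSet a k => zeroTerm a k s q)
      (s * (Real.cosh (s * a) * Real.cosh s) / hypRootFun a k s) := by
  obtain ⟨C, hC, hbound⟩ := exists_cos_mul_cos_le ha hk hka hreal hs
  have hsummable : Summable fun q : zeroSet a k => zeroTerm a k s q := by
    refine Summable.of_norm_bounded
      ((summable_inv_sq_add_one ha hk hka hreal hs).mul_left (C * (s ^ 2 + 1))) fun q => ?_
    exact (abs_zeroTerm_le hs0 (hbound q (rootFun_ofReal_eq_zero.1 q.2))).1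
  obtain ⟨Z, hZS, hSZ, hlim⟩ := exists_tendsto_sum_residues ha hk hka hreal hs
  refine hasSum_subtype_of_tendsto hZS hSZ hsummable ?_
  have hF := hreal.hypRootFun_ne_zero hs0
  have hFI : ((hypRootFun a k s : ℝ) : ℂ) * Complex.I ≠ 0 :=
    mul_ne_zero (by exact_mod_cast hF) Complex.I_ne_zero
  -- The factor s² matches 1/(1 + q²/s²) = s²/((q - is)(q + is)).
  have h := hlim (fun z => ((s ^ 2 : ℝ) : ℂ) * (Complex.cos (z * a) * Complex.cos z)) (s ^ 2)
    (by fun_prop)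
    (fun z => by
      rw [norm_mul, Complex.norm_real, Real.norm_of_nonneg (sq_nonneg s)]
      exact mul_le_mul_of_nonneg_left (norm_cos_mul_cos_le ha z) (sq_nonneg s))
    (s * Complex.I) (-(s * Complex.I))
    (fun h => by
      have := congrArg Complex.im h
      simp at this
      linarith)
    (by rwa [rootFun_mul_I]) (by rwa [rootFun_neg_mul_I, neg_ne_zero])
  have hre := (Complex.continuous_re.tendsto _).comp h
  have hsC : (s : ℂ) ≠ 0 := by exact_mod_cast hs0.ne'
  have hFC : ((hypRootFun a k s : ℝ) : ℂ) ≠ 0 := by exact_mod_cast hF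
  convert! hre using 2
  · rename_i n
    simp only [Function.comp]
    rw [Complex.re_sum]
    refine Finset.sum_congr rfl fun q hq => ?_
    rw [I_sq_add, rootDeriv_ofReal, ← Complex.ofReal_cos, ← Complex.ofReal_mul q a,
      ← Complex.ofReal_cos]
    norm_cast
    have h1 : realRootDeriv a k q ≠ 0 := fun h' =>
      hs q (hZS n q hq) (rootDeriv_ofReal_eq_zero.2 h')
    rw [zeroTerm]
    field_simp
    ring
  · rw [rootFun_mul_I, rootFun_neg_mul_I]
    simp only [neg_mul, Complex.cos_neg, cos_mul_cos_mul_I]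
    rw [← Complex.ofReal_re (s * (Real.cosh (s * a) * Real.cosh s) / hypRootFun a k s)]
    congr 1
    push_cast
    field_simp
    ring_nf
    simp only [Complex.I_sq]
    ring

theorem zeroTerm_zero (a k s : ℝ) : zeroTerm a k s 0 = 1 / (1 - k * a) := by
  simp [zeroTerm, realRootDeriv]

theorem hasSum_posZeros {a k : ℝ} (ha : 0 < a) (hk : k ≠ 1) (hka : k * a ≠ 1)
    (hreal : RealZeros a k) (hs : SimpleZeros a k) {s : ℝ} (hs0 : 0 < s) :
    Summable (fun q : posZeros a k => zeroTerm a k s q) ∧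
      1 / (1 - k * a) + 2 * ∑' q : posZeros a k, zeroTerm a k s q =
        s * (Real.cosh (s * a) * Real.cosh s) / hypRootFun a k s := by
  have h := hasSum_zeroTerm ha hk hka hreal hs hs0
  set V := s * (Real.cosh (s * a) * Real.cosh s) / hypRootFun a k s
  have h1 : HasSum ((zeroSet a k).indicator (zeroTerm a k s)) V :=
    (hasSum_subtype_iff_indicator (f := zeroTerm a k s)).1 h
  set φ := (zeroSet a k).indicator (zeroTerm a k s) with hφ
  have hφneg : ∀ q, φ (-q) = φ q := by
    intro q
    have e : -q ∈ zeroSet a k ↔ q ∈ zeroSet a k := by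
      simp only [zeroSet, Set.mem_ofPred_eq, Complex.ofReal_neg, rootFun_neg, neg_eq_zero]
    by_cases hq : q ∈ zeroSet a k
    · rw [hφ, Set.indicator_of_mem hq, Set.indicator_of_mem (e.2 hq), zeroTerm_neg]
    · rw [hφ, Set.indicator_of_notMem hq, Set.indicator_of_notMem fun h => hq (e.1 h)]
  have hpos : (Set.Ioi (0 : ℝ)).indicator φ = (posZeros a k).indicator (zeroTerm a k s) := by
    ext q
    by_cases hq : q ∈ posZeros a k
    · rw [Set.indicator_of_mem hq, Set.indicator_of_mem (show q ∈ Set.Ioi (0 : ℝ) from hq.1), hφ,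
        Set.indicator_of_mem (show q ∈ zeroSet a k from rootFun_ofReal_eq_zero.2 hq.2.2.2)]
    · rw [Set.indicator_of_notMem hq]
      by_cases hq0 : q ∈ Set.Ioi (0 : ℝ)
      · rw [Set.indicator_of_mem hq0, hφ]
        by_cases hqz : q ∈ zeroSet a k
        · rw [Set.indicator_of_mem hqz]
          -- Zeros of F at which a tangent is undefined are not roots of the tangent equation, but
          -- their terms vanish.
          have h2 : Real.cos (q * a) * Real.cos q = 0 := by
            by_contra hne
            exact hq ⟨hq0, right_ne_zero_of_mul hne, left_ne_zero_of_mul hne,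
              rootFun_ofReal_eq_zero.1 hqz⟩
          rw [zeroTerm, h2, zero_div]
        · rw [Set.indicator_of_notMem hqz]
      · rw [Set.indicator_of_notMem hq0]
  have hsum : Summable ((Set.Ioi (0 : ℝ)).indicator φ) := h1.summable.indicator _
  have h2 := hsum.hasSum
  have h3 := (Equiv.neg ℝ).hasSum_iff.2 h2
  have h4 := (h2.add h3).add (hasSum_ite_eq (0 : ℝ) (φ 0))
  have h5 : φ = fun q => (Set.Ioi (0 : ℝ)).indicator φ q +
      ((Set.Ioi (0 : ℝ)).indicator φ ∘ Equiv.neg ℝ) q + (if q = 0 then φ 0 else 0) := by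
    ext q
    simp only [Function.comp, Equiv.neg_apply, Set.indicator_apply, Set.mem_Ioi, hφneg,
      Left.neg_pos_iff]
    rcases lt_trichotomy q 0 with hq | rfl | hq
    · simp [hq, hq.ne, hq.le]
    · simp
    · simp [hq, hq.ne', hq.le]
  rw [← h5] at h4
  have h6 := h1.unique h4
  have hφ0 : φ 0 = 1 / (1 - k * a) := by
    rw [hφ, Set.indicator_of_mem, zeroTerm_zero]
    simp [zeroSet, rootFun_zero]
  rw [hφ0, hpos, ← tsum_subtype] at h6
  rw [hpos] at hsum
  exact ⟨summable_subtype_iff_indicator.2 hsum, by rw [h6]; ring⟩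

theorem infinite_posZeros {a k : ℝ} (ha : 0 < a) (hk : k ≠ 1) (hka : k * a ≠ 1)
    (hreal : RealZeros a k) (hs : SimpleZeros a k) : (posZeros a k).Infinite := by
  intro hfin
  have : Fintype (posZeros a k) := hfin.fintype
  obtain ⟨C, hC, hbound⟩ := exists_cos_mul_cos_le ha hk hka hreal hs
  set B := |1 / (1 - k * a)| + 2 * ∑ _q : posZeros a k, C with hB
  have hB0 : 0 ≤ B := by
    have : 0 ≤ ∑ _q : posZeros a k, C := Finset.sum_nonneg fun _ _ => hC
    positivity
  -- Finitely many bounded terms keep the left side at most B for every s, whereas the right side is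
  -- at least s/(1 + |k|) = B + 1 in modulus.
  set s := (B + 1) * (1 + |k|) with hs'
  have hs0 : 0 < s := by positivity
  have h := (hasSum_posZeros ha hk hka hreal hs hs0).2
  have hF := hreal.hypRootFun_ne_zero hs0
  have hle : |1 / (1 - k * a) + 2 * ∑' q : posZeros a k, zeroTerm a k s q| ≤ B := by
    refine (abs_add_le _ _).trans ?_
    rw [abs_mul, abs_two, tsum_fintype, hB]
    gcongr
    refine (Finset.abs_sum_le_sum_abs _ _).trans (Finset.sum_le_sum fun q _ => ?_)
    exact (abs_zeroTerm_le hs0 (hbound q q.2.2.2.2)).2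
  rw [h] at hle
  have hN : 0 < Real.cosh (s * a) * Real.cosh s :=
    mul_pos (Real.cosh_pos _) (Real.cosh_pos _)
  have hsinh : ∀ {x : ℝ}, 0 < x → 0 ≤ Real.sinh x ∧ Real.sinh x ≤ Real.cosh x := fun hx =>
    ⟨(Real.sinh_pos_iff.2 hx).le, (Real.sinh_lt_cosh _).le⟩
  obtain ⟨h1, h2⟩ := hsinh hs0
  obtain ⟨h3, h4⟩ := hsinh (mul_pos hs0 ha)
  have hFle : |hypRootFun a k s| ≤ (1 + |k|) * (Real.cosh (s * a) * Real.cosh s) := by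
    refine (abs_sub _ _).trans ?_
    rw [abs_mul k, abs_of_nonneg (mul_nonneg h1 (Real.cosh_pos _).le),
      abs_of_nonneg (mul_nonneg (Real.cosh_pos _).le h3), add_mul, one_mul]
    refine add_le_add ?_ (mul_le_mul_of_nonneg_left ?_ (abs_nonneg k))
    · rw [mul_comm]
      exact mul_le_mul_of_nonneg_left h2 (Real.cosh_pos _).le
    · rw [mul_comm]
      exact mul_le_mul_of_nonneg_right h4 (Real.cosh_pos _).le
  rw [abs_div, abs_of_pos (mul_pos hs0 hN), div_le_iff₀ (abs_pos.2 hF)] at hle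
  have h5 := hle.trans (mul_le_mul_of_nonneg_left hFle hB0)
  have h6 : 0 < (1 + |k|) * (Real.cosh (s * a) * Real.cosh s) := by positivity
  rw [hs'] at h5
  rw [hs'] at h6
  nlinarith

/-! ### Enumeration of the roots -/

/-- An infinite locally finite set of positive reals is the range of a strictly increasing
sequence. -/
theorem exists_strictMono_range_eq {S : Set ℝ} (hpos : ∀ x ∈ S, 0 < x) (hinf : S.Infinite)
    (hfin : ∀ R, (S ∩ Set.Icc (-R) R).Finite) : ∃ q : ℕ → ℝ, StrictMono q ∧ Set.range q = S := by
  have hIcc : ∀ x y : S, (Set.Icc x y).Finite := by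
    intro x y
    refine Set.Finite.of_finite_image (f := Subtype.val) ((hfin y).subset ?_)
      Subtype.val_injective.injOn
    rintro _ ⟨z, hz, rfl⟩
    refine ⟨z.2, ?_, hz.2⟩
    have h1 := hpos z z.2
    have h2 := hpos y y.2
    linarith
  let _ : LocallyFiniteOrder S := LocallyFiniteOrder.ofFiniteIcc hIcc
  let _ : SuccOrder S := LinearLocallyFiniteOrder.succOrder S
  let _ : PredOrder S := LinearLocallyFiniteOrder.predOrder S
  obtain ⟨x₀, hx₀⟩ := hinf.nonempty
  have hfin₀ : (S ∩ Set.Icc (-x₀) x₀).Finite := hfin x₀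
  obtain ⟨m, hm, hmin⟩ := hfin₀.exists_minimal
    ⟨x₀, hx₀, by have := hpos x₀ hx₀; constructor <;> linarith⟩
  let _ : OrderBot S :=
    { bot := ⟨m, hm.1⟩
      bot_le := fun y => by
        change m ≤ y
        by_contra! hlt
        have h1 := hpos y y.2
        have h2 := hpos x₀ hx₀
        have h3 := hmin (y := (y : ℝ)) ⟨y.2, by linarith, by linarith [hm.2.2]⟩ hlt.le
        linarith }
  have hmax : NoMaxOrder S := ⟨fun x => by
    by_contra! hall
    refine hinf ((hfin x).subset fun y hy => ⟨hy, ?_, hall ⟨y, hy⟩⟩)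
    have h1 := hpos y hy
    have h2 := hpos x x.2
    linarith⟩
  -- A locally finite linear order with a least and no greatest element is order isomorphic to ℕ.
  let e : S ≃o ℕ := orderIsoNatOfLinearSuccPredArch
  refine ⟨fun n => e.symm n, fun i j hij => e.symm.strictMono hij, ?_⟩
  ext x
  constructor
  · rintro ⟨n, rfl⟩; exact (e.symm n).2
  · intro hx; exact ⟨e ⟨x, hx⟩, by simp⟩

/-! ### Real and simple zeros from the sign of k -/

theorem realZeros_of_nonpos {a k : ℝ} (ha : 0 < a) (hk : k ≤ 0) : RealZeros a k := by
  intro z hz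
  by_contra hy
  have hconj : ∀ w : ℂ, (Complex.sin w * (starRingEnd ℂ) (Complex.cos w)).im =
      Real.sinh (2 * w.im) / 2 := by
    intro w
    have e : Complex.sin w * (starRingEnd ℂ) (Complex.cos w) =
        ((Real.sin (2 * w.re) / 2 : ℝ) : ℂ) + ((Real.sinh (2 * w.im) / 2 : ℝ) : ℂ) * Complex.I := by
      have h1 := Complex.sin_add w ((starRingEnd ℂ) w)
      have h2 := Complex.sin_sub w ((starRingEnd ℂ) w)
      rw [Complex.add_conj] at h1
      rw [Complex.sub_conj, Complex.sin_mul_I] at h2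
      rw [← Complex.cos_conj]
      push_cast at h1 h2 ⊢
      linear_combination (-1 / 2) * h1 - (1 / 2) * h2
    rw [e]
    simp [-Complex.ofReal_div]
  have hroot : Complex.sin z * Complex.cos (z * a) =
      k * (Complex.cos z * Complex.sin (z * a)) := sub_eq_zero.1 hz
  -- The imaginary part of the root equation multiplied by the conjugates of cos z and cos(az). For
  -- Im z ≠ 0 the left side has the sign of Im z, while for k ≤ 0 the right side is zero or of the
  -- opposite sign.
  have h1 : Complex.normSq (Complex.cos (z * a)) * Real.sinh (2 * z.im) =
      k * (Complex.normSq (Complex.cos z) * Real.sinh (2 * (z * a).im)) := by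
    have h2 : (Complex.normSq (Complex.cos (z * a)) : ℂ) *
          (Complex.sin z * (starRingEnd ℂ) (Complex.cos z)) =
        ((k * Complex.normSq (Complex.cos z) : ℝ) : ℂ) *
          (Complex.sin (z * a) * (starRingEnd ℂ) (Complex.cos (z * a))) := by
      push_cast
      rw [Complex.normSq_eq_conj_mul_self, Complex.normSq_eq_conj_mul_self]
      linear_combination ((starRingEnd ℂ) (Complex.cos (z * a)) *
        (starRingEnd ℂ) (Complex.cos z)) * hroot
    have h3 := congrArg Complex.im h2
    rw [Complex.im_ofReal_mul, Complex.im_ofReal_mul, hconj, hconj] at h3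
    linarith
  have hcos : ∀ w : ℂ, w.im ≠ 0 → 0 < Complex.normSq (Complex.cos w) := by
    intro w hw
    rw [Complex.normSq_pos]
    intro h0
    have h2 := hconj w
    rw [h0, map_zero, mul_zero, Complex.zero_im] at h2
    have h3 : Real.sinh (2 * w.im) = 0 := by linarith
    rw [Real.sinh_eq_zero] at h3
    exact hw (by linarith)
  have him : (z * a).im = z.im * a := Complex.im_mul_ofReal z a
  have hc1 := hcos (z * a) (by rw [him]; exact mul_ne_zero hy ha.ne')
  have hc2 := hcos z hy
  rw [him] at h1
  rcases lt_or_gt_of_ne hy with h | h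
  · have h2 : Real.sinh (2 * z.im) < 0 := Real.sinh_neg_iff.2 (by linarith)
    have h3 : Real.sinh (2 * (z.im * a)) < 0 := Real.sinh_neg_iff.2 (by nlinarith)
    have h4 := mul_neg_of_pos_of_neg hc1 h2
    have h5 := mul_nonneg_of_nonpos_of_nonpos hk (mul_neg_of_pos_of_neg hc2 h3).le
    linarith
  · have h2 : 0 < Real.sinh (2 * z.im) := Real.sinh_pos_iff.2 (by linarith)
    have h3 : 0 < Real.sinh (2 * (z.im * a)) := Real.sinh_pos_iff.2 (by positivity)
    have h4 := mul_pos hc1 h2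
    have h5 := mul_nonpos_of_nonpos_of_nonneg hk (mul_pos hc2 h3).le
    linarith

theorem simpleZeros_of_pos {a k : ℝ} (hka : k * a ≠ 1)
    (h : ∀ q : ℝ, 0 < q → realRootFun a k q = 0 → realRootDeriv a k q ≠ 0) : SimpleZeros a k := by
  intro x hx hx'
  rcases lt_trichotomy x 0 with hx0 | rfl | hx0
  · refine h (-x) (by linarith) (rootFun_ofReal_eq_zero.1 ?_) (rootDeriv_ofReal_eq_zero.1 ?_)
    · rw [Complex.ofReal_neg, rootFun_neg, hx, neg_zero]
    · rw [Complex.ofReal_neg, rootDeriv_neg, hx']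
  · rw [Complex.ofReal_zero, rootDeriv_zero] at hx'
    exact hka (by exact_mod_cast (sub_eq_zero.1 hx').symm)
  · exact h x hx0 (rootFun_ofReal_eq_zero.1 hx) (rootDeriv_ofReal_eq_zero.1 hx')

/-- For k < 0 the residue bound at a multiple zero forces cos(ax) cos x = 0, and then F' = 0 forces
sin(ax) sin x = 0; every combination contradicts sin² + cos² = 1 or the root equation. -/
theorem simpleZeros_of_neg {a k : ℝ} (ha : 0 < a) (hk : k < 0) : SimpleZeros a k := by
  intro x hx hx'
  rw [rootFun_ofReal_eq_zero] at hx
  rw [rootDeriv_ofReal_eq_zero] at hx'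
  have hka : k * a < 0 := mul_neg_of_neg_of_pos hk ha
  have hle : k * (a - k) * (1 - k * a) ≤ 0 :=
    mul_nonpos_of_nonpos_of_nonneg (mul_nonpos_of_nonpos_of_nonneg hk.le (by linarith))
      (by linarith)
  have h := mul_cos_mul_cos_le_of_rootFun_eq_zero hle hx
  rw [hx', abs_zero] at h
  have h1 : 0 < |1 - k * a| := abs_pos.2 (by linarith)
  have hN : Real.cos (x * a) * Real.cos x = 0 := by
    rw [← abs_nonpos_iff]
    exact nonpos_of_mul_nonpos_right h h1
  have hss : Real.sin (x * a) * Real.sin x = 0 := by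
    rw [realRootDeriv, hN, mul_zero, zero_sub, neg_eq_zero] at hx'
    exact (mul_eq_zero.1 hx').resolve_left (by linarith)
  rw [realRootFun] at hx
  have h2 := Real.sin_sq_add_cos_sq x
  have h3 := Real.sin_sq_add_cos_sq (x * a)
  rcases mul_eq_zero.1 hN with hc | hc <;> rcases mul_eq_zero.1 hss with hd | hd
  · norm_num [hc, hd] at h3
  · rw [hc, hd, mul_zero, zero_sub, neg_eq_zero, mul_eq_zero, or_iff_right hk.ne,
      mul_eq_zero] at hx
    rcases hx with hx | hx
    · norm_num [hx, hd] at h2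
    · norm_num [hx, hc] at h3
  · rw [hc, hd, mul_zero, mul_zero, sub_zero, mul_eq_zero] at hx
    rcases hx with hx | hx
    · norm_num [hx, hc] at h2
    · norm_num [hx, hd] at h3
  · norm_num [hc, hd] at h2

/-! ### Translation to ε, γ and p -/

theorem G_eq_realRootDeriv {ε : ℝ} (hε : 0 < ε) (γ q : ℝ) :
    G ε γ q = realRootDeriv (√ε) (γ / √ε) q := by
  have h : √ε ≠ 0 := (Real.sqrt_pos.2 hε).ne'
  rw [G, realRootDeriv, div_mul_cancel₀ _ h]
  ring

theorem summand_eq_zeroTerm {ε p : ℝ} (hε : 0 < ε) (hp : 0 < p) (γ q : ℝ) :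
    summand ε γ p q = zeroTerm (√ε) (γ / √ε) (√p) q := by
  rw [summand, zeroTerm, G_eq_realRootDeriv hε, Real.sq_sqrt hp.le]

theorem posRoots_eq_posZeros (ε γ : ℝ) : posRoots ε γ = posZeros (√ε) (γ / √ε) := by
  ext q
  simp only [posRoots, posZeros, Set.mem_ofPred_eq, realRootFun, sub_eq_zero]
  refine and_congr_right fun _ => and_congr_right fun h1 => and_congr_right fun h2 => ?_
  rw [Real.tan_eq_sin_div_cos, Real.tan_eq_sin_div_cos, ← mul_div_assoc, div_eq_div_iff h1 h2]
  constructor <;> intro h <;> linarith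

theorem realZeros_sqrt {ε γ : ℝ} (hε : 0 < ε) (h : γ ≤ 0 ∨ OnlyRealRoots ε γ) :
    RealZeros (√ε) (γ / √ε) := by
  rcases h with h | h
  · exact realZeros_of_nonpos (Real.sqrt_pos.2 hε) (div_nonpos_of_nonpos_of_nonneg h (by positivity))
  · intro z hz
    exact h z (sub_eq_zero.1 hz)

theorem simpleZeros_sqrt {ε γ : ℝ} (hε : 0 < ε) (hγ : γ ≠ 1) (h : γ < 0 ∨ OnlySimpleRoots ε γ) :
    SimpleZeros (√ε) (γ / √ε) := by
  have hs : 0 < √ε := Real.sqrt_pos.2 hε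
  rcases h with h | h
  · exact simpleZeros_of_neg hs (div_neg_of_neg_of_pos h hs)
  · refine simpleZeros_of_pos (by rwa [div_mul_cancel₀ _ hs.ne']) fun q hq hq0 => ?_
    rw [← G_eq_realRootDeriv hε]
    exact h q hq (sub_eq_zero.1 hq0)

theorem hypRootFun_eq_mul {a s : ℝ} (k : ℝ) (hs : 0 < s) :
    hypRootFun a k s = Real.sinh s * Real.cosh (s * a) *
      (1 - k * coth s * Real.tanh (s * a)) := by
  have h1 : Real.sinh s ≠ 0 := (Real.sinh_pos_iff.2 hs).ne'
  have h2 : Real.cosh (s * a) ≠ 0 := (Real.cosh_pos _).ne'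
  rw [hypRootFun, coth, Real.tanh_eq_sinh_div_cosh]
  field_simp

theorem exists_root_series {ε γ : ℝ} (hε : 0 < ε) (hγ : γ ≠ 1) (hγε : γ ≠ √ε)
    (ha : γ ≤ 0 ∨ OnlyRealRoots ε γ) (hb : γ < 0 ∨ OnlySimpleRoots ε γ) :
    ∃ q : ℕ → ℝ, StrictMono q ∧ Set.range q = posRoots ε γ ∧
      (∀ n, G ε γ (q n) ≠ 0) ∧
      ∀ p : ℝ, 0 < p →
        1 - γ / √ε * coth (√p) * Real.tanh (√(ε * p)) ≠ 0 ∧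
        Summable (fun n => summand ε γ p (q n)) ∧
        1 / (1 - γ) + 2 * ∑' n, summand ε γ p (q n) =
          √p * coth (√p) / (1 - γ / √ε * coth (√p) * Real.tanh (√(ε * p))) := by
  have hs : 0 < √ε := Real.sqrt_pos.2 hε
  have hk : γ / √ε ≠ 1 := fun h => hγε ((div_eq_one_iff_eq hs.ne').1 h)
  have hka' : γ / √ε * √ε = γ := div_mul_cancel₀ _ hs.ne'
  have hka : γ / √ε * √ε ≠ 1 := by rwa [hka']
  have hreal := realZeros_sqrt hε ha
  have hsimple := simpleZeros_sqrt hε hγ hb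
  obtain ⟨q, hq, hrange⟩ := exists_strictMono_range_eq (S := posZeros (√ε) (γ / √ε))
    (fun x hx => hx.1) (infinite_posZeros hs hk hka hreal hsimple) (fun R =>
      (hsimple.finite_inter R).subset (Set.inter_subset_inter_left _ fun x hx =>
        rootFun_ofReal_eq_zero.2 hx.2.2.2))
  have hmem : ∀ n, q n ∈ posZeros (√ε) (γ / √ε) := fun n => hrange ▸ Set.mem_range_self n
  refine ⟨q, hq, hrange.trans (posRoots_eq_posZeros ε γ).symm, fun n h => ?_, fun p hp => ?_⟩
  · rw [G_eq_realRootDeriv hε] at h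
    exact hsimple (q n) (rootFun_ofReal_eq_zero.2 (hmem n).2.2.2) (rootDeriv_ofReal_eq_zero.2 h)
  · have hp0 : 0 < √p := Real.sqrt_pos.2 hp
    obtain ⟨h1, h2⟩ := hasSum_posZeros hs hk hka hreal hsimple hp0
    have hF := hreal.hypRootFun_ne_zero hp0
    rw [hypRootFun_eq_mul _ hp0] at hF h2
    have hsqrt : √(ε * p) = √p * √ε := by rw [Real.sqrt_mul hε.le, mul_comm]
    rw [hsqrt]
    have hden := right_ne_zero_of_mul hF
    simp only [summand_eq_zeroTerm hε hp]
    refine ⟨hden, ?_, ?_⟩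
    · rw [← hrange] at h1
      exact h1.comp_injective (i := Set.rangeFactorization q)
        fun i j hij => hq.injective (congrArg Subtype.val hij)
    · rw [← hrange, tsum_range _ hq.injective, hka'] at h2
      rw [h2]
      have h3 : Real.sinh (√p) ≠ 0 := (Real.sinh_pos_iff.2 hp0).ne'
      have h4 : Real.cosh (√p * √ε) ≠ 0 := (Real.cosh_pos _).ne'
      set d := 1 - γ / √ε * coth (√p) * Real.tanh (√p * √ε)
      rw [coth]
      field_simp

/-! ### The case γ = 0 and the hyperbolic cotangent -/

theorem posRoots_zero {ε : ℝ} (hcos : ∀ n : ℕ, 1 ≤ n → Real.cos (n * Real.pi * √ε) ≠ 0) :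
    posRoots ε 0 = Set.range (fun n : ℕ => ((n : ℝ) + 1) * Real.pi) := by
  ext q
  simp only [posRoots, Set.mem_ofPred_eq, zero_div, zero_mul, Set.mem_range]
  constructor
  · rintro ⟨hq, h1, -, h2⟩
    rw [Real.tan_eq_sin_div_cos, div_eq_zero_iff, or_iff_left h1, Real.sin_eq_zero_iff] at h2
    obtain ⟨m, hm⟩ := h2
    have hm0 : 0 < m := by
      have : (0 : ℝ) < m := pos_of_mul_pos_left (hm ▸ hq) Real.pi_pos.le
      exact_mod_cast this
    refine ⟨(m - 1).toNat, ?_⟩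
    have e : (((m - 1).toNat : ℕ) : ℝ) = m - 1 := by
      have : (((m - 1).toNat : ℕ) : ℤ) = m - 1 := Int.toNat_of_nonneg (by omega)
      exact_mod_cast congrArg (Int.cast : ℤ → ℝ) this
    rw [e, ← hm]; ring
  · rintro ⟨n, rfl⟩
    have hs : Real.sin (((n : ℝ) + 1) * Real.pi) = 0 := by
      exact_mod_cast Real.sin_nat_mul_pi (n + 1)
    refine ⟨by have := Real.pi_pos; positivity, fun h => ?_, ?_, ?_⟩
    · have := Real.sin_sq_add_cos_sq (((n : ℝ) + 1) * Real.pi)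
      rw [hs, h] at this
      norm_num at this
    · exact_mod_cast hcos (n + 1) (by omega)
    · rw [Real.tan_eq_sin_div_cos, hs, zero_div]

theorem onlyRealRoots_zero {ε : ℝ} (hε : 0 < ε) : OnlyRealRoots ε 0 := fun z hz =>
  realZeros_sqrt hε (Or.inl le_rfl) z (sub_eq_zero.2 hz)

theorem onlySimpleRoots_zero {ε : ℝ} (hε : 0 < ε)
    (hcos : ∀ n : ℕ, 1 ≤ n → Real.cos (n * Real.pi * √ε) ≠ 0) : OnlySimpleRoots ε 0 := by
  intro q hq hroot hG
  have hs : √ε ≠ 0 := (Real.sqrt_pos.2 hε).ne'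
  rw [zero_div, zero_mul, mul_eq_zero] at hroot
  simp only [G, sub_zero, zero_div, one_mul] at hG
  have h2 := Real.sin_sq_add_cos_sq q
  have h3 := Real.sin_sq_add_cos_sq (q * √ε)
  -- Here F = sin q cos(q√ε), so a multiple zero is a common zero of both factors, which the cosine
  -- hypothesis excludes.
  by_cases hsin : Real.sin q = 0
  · have hc : Real.cos q ≠ 0 := fun h => by rw [hsin, h] at h2; norm_num at h2
    rw [hsin, mul_zero, sub_zero, mul_eq_zero, or_iff_left hc] at hG
    obtain ⟨m, hm⟩ := Real.sin_eq_zero_iff.1 hsin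
    have hm0 : 0 < m := by
      have : (0 : ℝ) < m := pos_of_mul_pos_left (hm ▸ hq) Real.pi_pos.le
      exact_mod_cast this
    lift m to ℕ using hm0.le
    refine hcos m (by omega) ?_
    rw [← hG, ← hm]
    push_cast
    rfl
  · have hc := hroot.resolve_left hsin
    rw [hc, zero_mul, zero_sub, neg_eq_zero, mul_eq_zero, or_iff_left hsin, mul_eq_zero,
      or_iff_right hs] at hG
    rw [hc, hG] at h3
    norm_num at h3

theorem summand_zero {ε : ℝ} (hcos : ∀ n : ℕ, 1 ≤ n → Real.cos (n * Real.pi * √ε) ≠ 0)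
    (p : ℝ) (n : ℕ) :
    summand ε 0 p (((n : ℝ) + 1) * Real.pi) =
      1 / (1 + ((n : ℝ) + 1) ^ 2 * Real.pi ^ 2 / p) := by
  have hq : ((n : ℝ) + 1) * Real.pi ∈ posRoots ε 0 := posRoots_zero hcos ▸ ⟨n, rfl⟩
  have hs : Real.sin (((n : ℝ) + 1) * Real.pi) = 0 := by
    exact_mod_cast Real.sin_nat_mul_pi (n + 1)
  have h := mul_ne_zero hq.2.2.1 hq.2.1
  simp only [summand, G, hs, sub_zero, mul_zero, one_mul, mul_pow]
  rw [mul_comm (1 + _), ← div_div, div_self h]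

theorem coth_series {p : ℝ} (hp : 0 < p) :
    Summable (fun n : ℕ => 1 / (1 + ((n : ℝ) + 1) ^ 2 * Real.pi ^ 2 / p)) ∧
      1 + 2 * ∑' n : ℕ, 1 / (1 + ((n : ℝ) + 1) ^ 2 * Real.pi ^ 2 / p) = √p * coth (√p) := by
  have hcos : ∀ n : ℕ, 1 ≤ n → Real.cos (n * Real.pi * √1) ≠ 0 := by
    intro n _ h
    have := Real.sin_sq_add_cos_sq (n * Real.pi)
    rw [Real.sqrt_one, mul_one] at h
    rw [h, Real.sin_nat_mul_pi] at this
    norm_num at this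
  -- For γ = 0 neither side depends on ε; ε = 1 is a choice for which cos(nπ√ε) never vanishes.
  obtain ⟨q, hq, hrange, -, hsum⟩ := exists_root_series (ε := 1) (γ := 0) one_pos zero_ne_one
    (by simp) (Or.inl le_rfl) (Or.inr (onlySimpleRoots_zero one_pos hcos))
  obtain ⟨-, h1, h2⟩ := hsum p hp
  have hmono : StrictMono fun n : ℕ => ((n : ℝ) + 1) * Real.pi := fun i j hij =>
    mul_lt_mul_of_pos_right (by have : (i : ℝ) < j := by exact_mod_cast hij
                                linarith) Real.pi_pos
  have hqeq : q = fun n : ℕ => ((n : ℝ) + 1) * Real.pi :=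
    (StrictMono.range_inj hq hmono).1 (hrange.trans (posRoots_zero hcos))
  rw [hqeq] at h1 h2
  simp only [summand_zero hcos] at h1 h2
  exact ⟨h1, by simpa using h2⟩

theorem pi_coth_series :
    Summable (fun n : ℕ => 1 / (1 + ((n : ℝ) + 1) ^ 2)) ∧
      1 + 2 * ∑' n : ℕ, 1 / (1 + ((n : ℝ) + 1) ^ 2) = Real.pi * coth Real.pi := by
  have hπ : Real.pi ^ 2 ≠ 0 := by have := Real.pi_pos; positivity
  have h := coth_series (p := Real.pi ^ 2) (by have := Real.pi_pos; positivity)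
  rw [Real.sqrt_sq Real.pi_pos.le] at h
  simpa only [mul_div_cancel_right₀ _ hπ] using h

end RootSeries

theorem mainTheorem2 :
    (∀ ε γ : ℝ, 0 < ε → γ ≠ 1 → γ ≠ √ε →
      (γ ≤ 0 ∨ OnlyRealRoots ε γ) → (γ < 0 ∨ OnlySimpleRoots ε γ) →
      ∃ q : ℕ → ℝ, StrictMono q ∧ Set.range q = posRoots ε γ ∧
        (∀ n, G ε γ (q n) ≠ 0) ∧
        ∀ p : ℝ, 0 < p →
          1 - γ / √ε * coth (√p) * Real.tanh (√(ε * p)) ≠ 0 ∧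
          Summable (fun n => summand ε γ p (q n)) ∧
          1 / (1 - γ) + 2 * ∑' n, summand ε γ p (q n) =
            √p * coth (√p) / (1 - γ / √ε * coth (√p) * Real.tanh (√(ε * p)))) ∧
    (∀ ε : ℝ, 0 < ε → (∀ n : ℕ, 1 ≤ n → Real.cos (n * Real.pi * √ε) ≠ 0) →
      OnlyRealRoots ε 0 ∧ OnlySimpleRoots ε 0 ∧
      posRoots ε 0 = Set.range (fun n : ℕ => ((n : ℝ) + 1) * Real.pi) ∧
      ∀ p : ℝ, 0 < p → ∀ n : ℕ,
        summand ε 0 p (((n : ℝ) + 1) * Real.pi) =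
          1 / (1 + ((n : ℝ) + 1) ^ 2 * Real.pi ^ 2 / p)) ∧
    (∀ p : ℝ, 0 < p →
      Summable (fun n : ℕ => 1 / (1 + ((n : ℝ) + 1) ^ 2 * Real.pi ^ 2 / p)) ∧
      1 + 2 * ∑' n : ℕ, 1 / (1 + ((n : ℝ) + 1) ^ 2 * Real.pi ^ 2 / p) = √p * coth (√p)) ∧
    (Summable (fun n : ℕ => 1 / (1 + ((n : ℝ) + 1) ^ 2)) ∧
      1 + 2 * ∑' n : ℕ, 1 / (1 + ((n : ℝ) + 1) ^ 2) = Real.pi * coth Real.pi) := by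
  exact ⟨fun _ _ hε hγ hγε ha hb => RootSeries.exists_root_series hε hγ hγε ha hb,
    fun _ hε hcos => ⟨RootSeries.onlyRealRoots_zero hε, RootSeries.onlySimpleRoots_zero hε hcos,
      RootSeries.posRoots_zero hcos, fun p _ n => RootSeries.summand_zero hcos p n⟩,
    fun _ hp => RootSeries.coth_series hp, RootSeries.pi_coth_series⟩
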